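/- Let $d\ge 1$, $\alpha>-1/2$, $\mathbb{R}^{d+1}_+=\mathbb{R}^d\times(0,\infty)$ with points $x=(x',x_{d+1})$, and let $d\mu_\alpha(x)=\kappa\,x_{d+1}^{2\alpha+1}\,dx$ on $\mathbb{R}^{d+1}_+$, where $\kappa$ is either of the two normalizing constants $\kappa=c_{d,\alpha}$ or $\kappa=c_{d,\alpha}^2$, with $c_{d,\alpha}=\big((2\pi)^{d/2}2^{\alpha}\Gamma(\alpha+1)\big)^{-1}$. Write $\|\cdot\|_{\alpha,p}$ for the norm of $L^p_\alpha=L^p(\mathbb{R}^{d+1}_+,\mu_\alpha)$ (complex-valued functions). Let $$j_\alpha(t)=\Gamma(\alpha+1)\sum_{k\ge0}\frac{(-1)^k (t/2)^{2k}}{k!\,\Gamma(\alpha+k+1)},\qquad \Lambda(x,\lambda)=e^{-i\langle x',\lambda'\rangle}j_\alpha(x_{d+1}\lambda_{d+1}).$$ The Weinstein transform is $\mathcal{F}_{W,\alpha}\varphi(\lambda)=\int \varphi(x)\Lambda(x,\lambda)\,d\mu_\alpha(x)$ for $\varphi\in L^1_\alpha$. Let $1<p\le 2$ and $q=p/(p-1)$.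 For $\varphi\in L^p_\alpha$, the transform $\mathcal{F}_{W,\alpha}\varphi\in L^q_\alpha$ denotes the value at $\varphi$ of the continuous extension $L^p_\alpha\to L^q_\alpha$ of the transform from $L^1_\alpha\cap L^p_\alpha$, i.e. the $L^q_\alpha$-limit of $\mathcal{F}_{W,\alpha}u_n$ for $u_n\in L^1_\alpha\cap L^p_\alpha$ with $u_n\to\varphi$ in $L^p_\alpha$. Let $\Omega,\Sigma\subseteq\mathbb{R}^{d+1}_+$ be measurable, $\varphi\in L^p_\alpha$, $\varepsilon_\Omega\ge 0$ and $0\le\varepsilon_\Sigma<1$. Suppose that $\varphi$ is $\varepsilon_\Omega$-concentrated to $\Omega$ in $L^p_\alpha$-norm and $\mathcal{F}_{W,\alpha}\varphi$ is $\varepsilon_\Sigma$-concentrated to $\Sigma$ in $L^q_\alpha$-norm, that is, $$\|\varphi-\chi_\Omega\varphi\|_{\alpha,p}\le\varepsilon_\Omega\|\varphi\|_{\alpha,p},\qquad \|\mathcal{F}_{W,\alpha}\varphi-\chi_\Sigma\mathcal{F}_{W,\alpha}\varphi\|_{\alpha,q}\le\varepsilon_\Sigma\|\mathcal{F}_{W,\alpha}\varphi\|_{\alpha,q}.$$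 Then $\mathcal{F}_{W,\alpha}\varphi$ exists as an element of $L^q_\alpha$, and $$\|\mathcal{F}_{W,\alpha}\varphi\|_{\alpha,q}\le\frac{\mu_\alpha(\Sigma)^{1/q}\mu_\alpha(\Omega)^{1/q}+\varepsilon_\Omega}{1-\varepsilon_\Sigma}\,\|\varphi\|_{\alpha,p},$$ where the right-hand side may be infinite and $0\cdot\infty=0$. -/

import Mathlib

open MeasureTheory Filter Topology
open scoped NNReal ENNReal

noncomputable section

/-- The ambient space `ℝ^d × ℝ`; a point is `x = (x', x_{d+1})`. -/
abbrev WSpace (d : ℕ) : Type := EuclideanSpace ℝ (Fin d) × ℝ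

/-- The open half space `ℝ^{d+1}_+ = ℝ^d × (0, ∞)`. -/
def halfSpace (d : ℕ) : Set (WSpace d) := {x | 0 < x.2}

/-- The constant `1 / ((2π)^{d/2} 2^α Γ(α+1))`. -/
def weinsteinConst (d : ℕ) (α : ℝ) : ℝ :=
  1 / ((2 * Real.pi) ^ ((d : ℝ) / 2) * (2 : ℝ) ^ α * Real.Gamma (α + 1))

/-- The measure `κ x_{d+1}^{2α+1} dx` carried by the half space. -/
def weinsteinMeasure (d : ℕ) (α κ : ℝ) : Measure (WSpace d) :=
  (volume.restrict (halfSpace d)).withDensity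
    (fun x => ENNReal.ofReal (κ * x.2 ^ (2 * α + 1)))

/-- The normalized Bessel function `j_α`, with `j_α(0) = 1`, the even solution of
`u'' + ((2α+1)/x) u' = -u`. -/
def besselJ (α x : ℝ) : ℝ :=
  Real.Gamma (α + 1) *
    ∑' k : ℕ, (-1 : ℝ) ^ k * (x / 2) ^ (2 * k) / ((k.factorial : ℝ) * Real.Gamma (α + k + 1))

/-- The Weinstein kernel `exp(-i⟨x', l'⟩) j_α(x_{d+1} l_{d+1})`. -/
def weinsteinKernel (d : ℕ) (α : ℝ) (x l : WSpace d) : ℂ :=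
  Complex.exp (-Complex.I * ((inner ℝ x.1 l.1 : ℝ) : ℂ)) * ((besselJ α (x.2 * l.2) : ℝ) : ℂ)

/-- The Weinstein transform of an integrable function, as an integral. -/
def weinsteinIntegral (d : ℕ) (α κ : ℝ) (φ : WSpace d → ℂ) (l : WSpace d) : ℂ :=
  ∫ x, φ x * weinsteinKernel d α x l ∂(weinsteinMeasure d α κ)

/-- `g ∈ L^q` is the Weinstein transform of `φ ∈ L^p`: it is the value at `φ` of the continuous
extension `L^p → L^q` of the integral transform on `L^1 ∩ L^p`, that is, the `L^q`-limit of the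
integral transforms of functions of `L^1 ∩ L^p` that converge to `φ` in `L^p`. -/
def IsWeinsteinTransform (d : ℕ) (α κ : ℝ) (p q : ℝ≥0∞) (φ g : WSpace d → ℂ) : Prop :=
  MemLp g q (weinsteinMeasure d α κ) ∧
  ∃ u : ℕ → WSpace d → ℂ,
    (∀ n, MemLp (u n) 1 (weinsteinMeasure d α κ) ∧ MemLp (u n) p (weinsteinMeasure d α κ)) ∧
    Tendsto (fun n => eLpNorm (u n - φ) p (weinsteinMeasure d α κ)) atTop (𝓝 0) ∧
    Tendsto (fun n => eLpNorm (weinsteinIntegral d α κ (u n) - g) q (weinsteinMeasure d α κ))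
      atTop (𝓝 0)

open Classical in
/-- The Weinstein transform of `φ ∈ L^p` (a representative of it). The value `0` is a placeholder
for functions `φ` at which the extension is not defined. -/
def weinsteinTransform (d : ℕ) (α κ : ℝ) (p q : ℝ≥0∞) (φ : WSpace d → ℂ) : WSpace d → ℂ :=
  if h : ∃ g, IsWeinsteinTransform d α κ p q φ g then h.choose else 0

/-- `f` is `ε`-concentrated to `S` in the `L^p(μ)`-norm: `‖f - f χ_S‖_p ≤ ε ‖f‖_p`. For `f` the
Weinstein transform of `φ`, the function `f χ_S` is the transform of `Q_S φ`, by the definition of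
the operator `Q_S`. -/
def IsConcentrated {X : Type*} [MeasurableSpace X] (μ : Measure X) (p : ℝ≥0∞) (ε : ℝ≥0)
    (S : Set X) (f : X → ℂ) : Prop :=
  eLpNorm (f - S.indicator f) p μ ≤ ε * eLpNorm f p μ

end

/-! Let g be the transform of φ, and split φ = χ_Ω φ + (φ - χ_Ω φ). By Hölder the first piece has
L¹-norm at most μ(Ω)^{1/q} ‖φ‖_p; since |Λ| ≤ 1, this number bounds its transform pointwise, so
restricting to Σ costs a factor μ(Σ)^{1/q} in L^q. The transform of the second piece has L^q-norm at
most ε_Ω ‖φ‖_p by Hausdorff–Young with constant 1. This bounds ‖χ_Σ g‖_q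
(`eLpNorm_indicator_le_of_isWeinsteinTransform`). Concentration of g gives ‖g‖_q ≤ ε_Σ ‖g‖_q + ‖χ_Σ
g‖_q, and the first term is absorbed because ‖g‖_q is finite.

The work lies in Hausdorff–Young (`eLpNorm_kernelIntegral_le`): the three lines theorem, applied to
the bilinear pairing, interpolates between the bound from |Λ| ≤ 1 and an L²-contraction. The
contraction (`lintegral_enorm_weinsteinIntegral_sq_le`) needs no inversion formula. Against the
weight exp(-t|l|²) the Gram kernel of Λ is a product of a Euclidean and a Bessel heat kernel:
symmetric, nonnegative and, for every t, of mass (κ/c)² with c = c_{d,α}. Schur's test applies when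
κ ≤ c, and Fatou removes the weight as t → 0. The Bessel factor is Weber's second exponential
integral, computed from power series. Both normalizations satisfy κ ≤ c because c ≤ 1. -/

/-! ### A lower bound for the Gamma function -/

/-- On [1, 2], convexity at the midpoint 3/2 of s and 3 - s gives Γ(s) + Γ(3 - s) ≥ 2 Γ(3/2) = √π,
while Γ(3 - s) ≤ 1; and √π - 1 ≥ 3/4. Monotonicity covers s ≥ 2, and Γ(s + 1) = s Γ(s) covers s < 1.
-/
theorem Real.three_quarters_le_Gamma {s : ℝ} (hs : 1 / 2 ≤ s) : 3 / 4 ≤ Real.Gamma s := by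
  have hconv := Real.convexOn_Gamma
  have hpi : (7 / 4 : ℝ) ≤ √Real.pi := by
    apply Real.le_sqrt_of_sq_le
    nlinarith [Real.pi_gt_d2]
  have h32 : Real.Gamma (3 / 2) = √Real.pi / 2 := by
    rw [show (3 / 2 : ℝ) = 1 / 2 + 1 by norm_num, Real.Gamma_add_one (by norm_num),
      Real.Gamma_one_half_eq]
    ring
  have key : ∀ s : ℝ, 1 ≤ s → s ≤ 2 → 3 / 4 ≤ Real.Gamma s := by
    intro s h1 h2
    have hA : Real.Gamma (3 - s) ≤ 1 := by
      have := hconv.le_max_of_mem_Icc (x := 1) (y := 2) (z := 3 - s) (by simp) (by simp)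
        ⟨by linarith, by linarith⟩
      simpa [Real.Gamma_one, Real.Gamma_two] using this
    have hB := hconv.2 (show s ∈ Set.Ioi (0 : ℝ) from by simp; linarith)
      (show 3 - s ∈ Set.Ioi (0 : ℝ) from by simp; linarith)
      (show (0 : ℝ) ≤ 1 / 2 by norm_num) (show (0 : ℝ) ≤ 1 / 2 by norm_num) (by norm_num)
    simp only [smul_eq_mul] at hB
    rw [show 1 / 2 * s + 1 / 2 * (3 - s) = 3 / 2 by ring, h32] at hB
    linarith
  rcases le_or_gt 2 s with h | h
  · have := Real.Gamma_strictMonoOn_Ici.monotoneOn (a := 2) (b := s) (by simp) (by simpa) h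
    rw [Real.Gamma_two] at this
    linarith
  · rcases le_or_gt 1 s with h1 | h1
    · exact key s h1 h.le
    · have h2 := key (s + 1) (by linarith) (by linarith)
      rw [Real.Gamma_add_one (by linarith)] at h2
      nlinarith [Real.Gamma_pos_of_pos (by linarith : 0 < s)]

/-! ### The Bessel series and the bound |j_α| ≤ 1 -/

/-- The entire function with `j_α(x) = Γ(α+1) * besselSeries α (x²/4)`. -/
noncomputable def besselSeries (β s : ℝ) : ℝ :=
  ∑' k : ℕ, (-s) ^ k / ((k.factorial : ℝ) * Real.Gamma (β + k + 1))

theorem abs_pow_div_factorial_mul_Gamma_le {β : ℝ} (hβ : -1 / 2 ≤ β) (s : ℝ) (k : ℕ) :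
    |(-s) ^ k / ((k.factorial : ℝ) * Real.Gamma (β + k + 1))| ≤
      4 / 3 * (|s| ^ k / k.factorial) := by
  have hG : 3 / 4 ≤ Real.Gamma (β + k + 1) :=
    Real.three_quarters_le_Gamma (by have : (0 : ℝ) ≤ k := by positivity
                                     linarith)
  have hk : (0 : ℝ) < k.factorial := by positivity
  have hG0 : 0 < Real.Gamma (β + k + 1) := by linarith
  have h0 : 0 ≤ |s| ^ k := by positivity
  rw [abs_div, abs_pow, abs_neg, abs_of_pos (mul_pos hk hG0), div_le_iff₀ (mul_pos hk hG0)]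
  calc |s| ^ k ≤ |s| ^ k * (4 / 3 * Real.Gamma (β + k + 1)) := by nlinarith
    _ = _ := by field_simp

theorem summable_besselSeries {β : ℝ} (hβ : -1 / 2 ≤ β) (s : ℝ) :
    Summable fun k : ℕ => (-s) ^ k / ((k.factorial : ℝ) * Real.Gamma (β + k + 1)) :=
  Summable.of_norm_bounded ((Real.summable_pow_div_factorial |s|).mul_left (4 / 3))
    (fun k => abs_pow_div_factorial_mul_Gamma_le hβ s k)

theorem hasDerivAt_besselSeries {β : ℝ} (hβ : -1 / 2 ≤ β) (s : ℝ) :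
    HasDerivAt (besselSeries β) (-besselSeries (β + 1) s) s := by
  set R : ℝ := |s| + 1
  let g : ℕ → ℝ → ℝ := fun k y => (-y) ^ k / ((k.factorial : ℝ) * Real.Gamma (β + k + 1))
  let g' : ℕ → ℝ → ℝ := fun k y =>
    (k * (-y) ^ (k - 1) * (-1)) / ((k.factorial : ℝ) * Real.Gamma (β + k + 1))
  have hshift : ∀ k y, g' (k + 1) y =
      -((-y) ^ k / ((k.factorial : ℝ) * Real.Gamma (β + 1 + k + 1))) := by
    intro k y
    have hG : Real.Gamma (β + 1 + k + 1) ≠ 0 := (Real.Gamma_pos_of_pos (by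
      have : (0 : ℝ) ≤ k := by positivity
      linarith)).ne'
    simp only [g', Nat.factorial_succ, Nat.add_sub_cancel]
    push_cast
    rw [show β + ((k : ℝ) + 1) + 1 = β + 1 + k + 1 by ring]
    field_simp
  have hzero : ∀ y, g' 0 y = 0 := by intro y; simp [g']
  -- The constant term has derivative 0; every later derivative is a term of the series for β + 1,
  -- so the majorant is an exponential series shifted by one.
  let u : ℕ → ℝ := fun k => Nat.casesOn k 0 (fun k => 4 / 3 * (R ^ k / k.factorial))
  have hu : Summable u := by
    rw [← summable_nat_add_iff 1]
    exact (Real.summable_pow_div_factorial R).mul_left (4 / 3)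
  have hbound : ∀ k y, y ∈ Metric.ball (0 : ℝ) R → ‖g' k y‖ ≤ u k := by
    intro k y hy
    have hy' : |y| ≤ R := by simpa using (Metric.mem_ball.1 hy).le
    cases k with
    | zero => rw [hzero]; simp [u]
    | succ k =>
      rw [hshift, norm_neg]
      refine (abs_pow_div_factorial_mul_Gamma_le (by linarith) y k).trans ?_
      simp only [u]
      gcongr
  have hs : s ∈ Metric.ball (0 : ℝ) R := by simp [R]
  have hd := hasDerivAt_tsum_of_isPreconnected (g := g) (g' := g') hu Metric.isOpen_ball
    (convex_ball (0 : ℝ) R).isPreconnected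
    (fun k y _ => (((hasDerivAt_id y).neg.pow k).div_const _)) hbound hs
    (summable_besselSeries hβ s) hs
  have hsum : Summable fun k => g' k s :=
    Summable.of_norm_bounded hu (fun k => hbound k s hs)
  have : ∑' k, g' k s = -besselSeries (β + 1) s := by
    rw [hsum.tsum_eq_zero_add, hzero, zero_add]
    simp only [hshift, besselSeries]
    rw [tsum_neg]
  rwa [this] at hd

/-- Together with `hasDerivAt_besselSeries` this is the Bessel equation s B'' + (β + 1) B' + B = 0.
On coefficients of index k + 1 it says β + k + 2 = (β + 1) + (k + 1). -/
theorem besselSeries_recurrence {β : ℝ} (hβ : -1 / 2 ≤ β) (s : ℝ) :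
    besselSeries β s = (β + 1) * besselSeries (β + 1) s - s * besselSeries (β + 2) s := by
  have h0 := summable_besselSeries hβ s
  have h1 := summable_besselSeries (show -1 / 2 ≤ β + 1 by linarith) s
  have h2 := summable_besselSeries (show -1 / 2 ≤ β + 2 by linarith) s
  have hpos : ∀ k : ℕ, 0 < β + k + 1 := fun k => by
    have : (0 : ℝ) ≤ k := by positivity
    linarith
  unfold besselSeries
  rw [h0.tsum_eq_zero_add, h1.tsum_eq_zero_add, mul_add, ← tsum_mul_left, ← tsum_mul_left,
    add_sub_assoc, ← Summable.tsum_sub (((summable_nat_add_iff 1).2 h1).mul_left _) (h2.mul_left _)]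
  congr 1
  · have := hpos 0
    simp only [Nat.cast_zero, add_zero] at this
    simp only [pow_zero, Nat.factorial_zero, Nat.cast_one, Nat.cast_zero, add_zero, one_mul]
    rw [Real.Gamma_add_one this.ne']
    have := (Real.Gamma_pos_of_pos this).ne'
    field_simp
  · congr 1
    ext k
    have hk := hpos k
    have e1 : β + ((k + 1 : ℕ) : ℝ) + 1 = (β + k + 1) + 1 := by push_cast; ring
    have e2 : β + 1 + ((k + 1 : ℕ) : ℝ) + 1 = (β + k + 1) + 1 + 1 := by push_cast; ring
    have e3 : β + 2 + (k : ℝ) + 1 = (β + k + 1) + 1 + 1 := by ring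
    rw [e1, e2, e3, Real.Gamma_add_one (s := β + k + 1 + 1) (by linarith), Nat.factorial_succ]
    have hG := (Real.Gamma_pos_of_pos (show 0 < β + k + 1 + 1 by linarith)).ne'
    have h4 : β + k + 2 ≠ 0 := by linarith
    push_cast
    field_simp
    ring

theorem besselSeries_zero (β : ℝ) : besselSeries β 0 = 1 / Real.Gamma (β + 1) := by
  unfold besselSeries
  rw [tsum_eq_single 0]
  · simp
  · intro k hk
    simp [hk]

/-- An energy argument: by the recurrence, B_β² + y B_{β+1}² has derivative -(2β + 1) B_{β+1}²,
which is nonpositive because β ≥ -1/2. Its value at 0 is the square of the bound. -/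
theorem abs_besselSeries_le {β : ℝ} (hβ : -1 / 2 ≤ β) {s : ℝ} (hs : 0 ≤ s) :
    |besselSeries β s| ≤ 1 / Real.Gamma (β + 1) := by
  let E : ℝ → ℝ := fun y => besselSeries β y ^ 2 + y * besselSeries (β + 1) y ^ 2
  have hE : ∀ y, HasDerivAt E (-(2 * β + 1) * besselSeries (β + 1) y ^ 2) y := by
    intro y
    have h0 := hasDerivAt_besselSeries hβ y
    have h1 := hasDerivAt_besselSeries (show -1 / 2 ≤ β + 1 by linarith) y
    convert! (h0.pow 2).add ((hasDerivAt_id y).mul (h1.pow 2)) using 1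
    rw [show β + 1 + 1 = β + 2 by ring]
    simp only [id, besselSeries_recurrence hβ y, Pi.pow_apply]
    push_cast
    ring
  have hanti : Antitone E := by
    apply antitone_of_deriv_nonpos (fun y => (hE y).differentiableAt)
    intro y
    rw [(hE y).deriv]
    have : 0 ≤ (2 * β + 1) * besselSeries (β + 1) y ^ 2 :=
      mul_nonneg (by linarith) (sq_nonneg _)
    linarith
  have h := hanti hs
  have hG : 0 < Real.Gamma (β + 1) := Real.Gamma_pos_of_pos (by linarith)
  simp only [E, besselSeries_zero, zero_mul, add_zero] at h
  apply abs_le_of_sq_le_sq _ (by positivity)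
  have : 0 ≤ s * besselSeries (β + 1) s ^ 2 := by positivity
  linarith

theorem besselJ_eq (α x : ℝ) :
    besselJ α x = Real.Gamma (α + 1) * besselSeries α (x ^ 2 / 4) := by
  unfold besselJ besselSeries
  congr 2
  ext k
  rw [pow_mul, ← mul_pow]
  congr 2
  ring

theorem abs_besselJ_le_one {α : ℝ} (hα : -1 / 2 ≤ α) (x : ℝ) : |besselJ α x| ≤ 1 := by
  have hG : 0 < Real.Gamma (α + 1) := Real.Gamma_pos_of_pos (by linarith)
  rw [besselJ_eq, abs_mul, abs_of_pos hG]
  calc _ ≤ Real.Gamma (α + 1) * (1 / Real.Gamma (α + 1)) := by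
        gcongr
        exact abs_besselSeries_le hα (by positivity)
    _ = 1 := by field_simp

theorem continuous_besselJ {α : ℝ} (hα : -1 / 2 ≤ α) : Continuous (besselJ α) := by
  have : Continuous (besselSeries α) :=
    continuous_iff_continuousAt.2 fun s => (hasDerivAt_besselSeries hα s).continuousAt
  simp only [funext (besselJ_eq α)]
  fun_prop

/-! ### Weber's second exponential integral -/

/-- A Chu–Vandermonde identity, by Pascal's rule in k. The extra sum becomes an instance with l - 1
and β + 1 through (m + 1) C(l + 1, m + 1) = (l + 1) C(l, m), which is why l and β vary in the
induction. -/
theorem sum_choose_mul_choose_div_Gamma (k : ℕ) : ∀ (l : ℕ) {β : ℝ}, -1 < β →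
    ∑ m ∈ Finset.range (k + 1),
        (k.choose m * l.choose m * m.factorial : ℝ) / Real.Gamma (β + m + 1) =
      Real.Gamma (β + (k + l : ℕ) + 1) /
        (Real.Gamma (β + k + 1) * Real.Gamma (β + l + 1)) := by
  induction k with
  | zero =>
    intro l β hβ
    have h1 : Real.Gamma (β + 1) ≠ 0 := (Real.Gamma_pos_of_pos (by linarith)).ne'
    have h2 : Real.Gamma (β + l + 1) ≠ 0 := (Real.Gamma_pos_of_pos (by
      have : (0 : ℝ) ≤ l := by positivity
      linarith)).ne'
    simp
    field_simp
  | succ k ih =>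
    intro l β hβ
    have hk : (0 : ℝ) ≤ k := by positivity
    have hG1 : Real.Gamma (β + k + 1) ≠ 0 := (Real.Gamma_pos_of_pos (by linarith)).ne'
    have hfirst : ∑ m ∈ Finset.range (k + 1),
        (k.choose (m + 1) * l.choose (m + 1) * (m + 1).factorial : ℝ) /
          Real.Gamma (β + (m + 1 : ℕ) + 1) + 1 / Real.Gamma (β + 1) =
        Real.Gamma (β + (k + l : ℕ) + 1) /
        (Real.Gamma (β + k + 1) * Real.Gamma (β + l + 1)) := by
      rw [← ih l hβ]
      have := Finset.sum_range_succ' (fun m : ℕ =>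
        (k.choose m * l.choose m * m.factorial : ℝ) / Real.Gamma (β + m + 1)) (k + 1)
      simp only [Nat.choose_zero_right, Nat.factorial_zero, Nat.cast_one, Nat.cast_zero, add_zero,
        one_mul] at this
      rw [← this, Finset.sum_range_succ]
      simp
    have hsplit : ∑ m ∈ Finset.range (k + 1 + 1),
        ((k + 1).choose m * l.choose m * m.factorial : ℝ) / Real.Gamma (β + m + 1) =
        ∑ m ∈ Finset.range (k + 1),
          (k.choose m * l.choose (m + 1) * (m + 1).factorial : ℝ) /
            Real.Gamma (β + (m + 1 : ℕ) + 1) +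
        Real.Gamma (β + (k + l : ℕ) + 1) /
        (Real.Gamma (β + k + 1) * Real.Gamma (β + l + 1)) := by
      rw [Finset.sum_range_succ', ← hfirst, ← add_assoc, ← Finset.sum_add_distrib]
      congr 1
      · refine Finset.sum_congr rfl fun m _ => ?_
        rw [Nat.choose_succ_succ]
        push_cast
        ring
      · simp
    rw [hsplit]
    have e1 : β + ((k + 1 : ℕ) : ℝ) + 1 = (β + k + 1) + 1 := by push_cast; ring
    cases l with
    | zero =>
      have h1 : Real.Gamma (β + 1) ≠ 0 := (Real.Gamma_pos_of_pos (by linarith)).ne'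
      have h2 : Real.Gamma (β + (k + 1) + 1) ≠ 0 := (Real.Gamma_pos_of_pos (by linarith)).ne'
      simp
      field_simp
    | succ l =>
      have hl : (0 : ℝ) ≤ l := by positivity
      have hsecond : ∑ m ∈ Finset.range (k + 1),
          (k.choose m * (l + 1).choose (m + 1) * (m + 1).factorial : ℝ) /
            Real.Gamma (β + (m + 1 : ℕ) + 1) = (l + 1) * (Real.Gamma (β + 1 + (k + l : ℕ) + 1) /
        (Real.Gamma (β + 1 + k + 1) * Real.Gamma (β + 1 + l + 1))) := by
        rw [← ih l (show -1 < β + 1 by linarith), Finset.mul_sum]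
        refine Finset.sum_congr rfl fun m _ => ?_
        have : ((l + 1).choose (m + 1) * (m + 1 : ℕ) : ℝ) = (l + 1) * l.choose m := by
          exact_mod_cast (Nat.add_one_mul_choose_eq l m).symm
        rw [show β + ((m + 1 : ℕ) : ℝ) + 1 = β + 1 + m + 1 by push_cast; ring,
          Nat.factorial_succ, ← mul_div_assoc]
        congr 1
        push_cast at this ⊢
        linear_combination (k.choose m * m.factorial : ℝ) * this
      rw [hsecond, show β + 1 + ((k + l : ℕ) : ℝ) + 1 = β + k + l + 2 by push_cast; ring,
        show β + 1 + k + 1 = β + k + 1 + 1 by ring, e1,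
        show β + ((k + (l + 1) : ℕ) : ℝ) + 1 = β + k + l + 2 by push_cast; ring,
        show β + ((k + 1 + (l + 1) : ℕ) : ℝ) + 1 = β + k + l + 2 + 1 by push_cast; ring,
        show β + 1 + l + 1 = β + l + 2 by ring,
        show β + ((l + 1 : ℕ) : ℝ) + 1 = β + l + 2 by push_cast; ring,
        Real.Gamma_add_one (s := β + k + l + 2) (by linarith),
        Real.Gamma_add_one (s := β + k + 1) (by linarith)]
      have hG2 : Real.Gamma (β + l + 2) ≠ 0 := (Real.Gamma_pos_of_pos (by linarith)).ne'
      have h3 : β + k + 1 ≠ 0 := by linarith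
      field_simp
      ring

theorem HasSum.mul_real {ι κ : Type*} {f : ι → ℝ} {g : κ → ℝ} {a b : ℝ} (hf : HasSum f a)
    (hg : HasSum g b) : HasSum (fun i : ι × κ => f i.1 * g i.2) (a * b) := by
  have h := summable_mul_of_summable_norm (f := f) (g := g) hf.summable.norm hg.summable.norm
  exact HasSum.mul hf hg h

theorem choose_div_factorial_mul_factorial (a b m : ℕ) (X g : ℝ) :
    X * (((a + m).choose m * (b + m).choose m * m.factorial : ℝ) / g) /
      ((a + m).factorial * (b + m).factorial : ℝ) =
      X / (a.factorial * b.factorial * (m.factorial * g)) := by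
  have h1 : ((a + m).choose m * a.factorial * m.factorial : ℝ) = (a + m).factorial := by
    exact_mod_cast Nat.add_choose_mul_factorial_mul_factorial a m
  have h2 : ((b + m).choose m * b.factorial * m.factorial : ℝ) = (b + m).factorial := by
    exact_mod_cast Nat.add_choose_mul_factorial_mul_factorial b m
  rw [← h1, ← h2]
  have c1 : ((a + m).choose m : ℝ) ≠ 0 := by
    exact_mod_cast (Nat.choose_pos (Nat.le_add_left m a)).ne'
  have c2 : ((b + m).choose m : ℝ) ≠ 0 := by
    exact_mod_cast (Nat.choose_pos (Nat.le_add_left m b)).ne'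
  have f1 : (a.factorial : ℝ) ≠ 0 := by positivity
  have f2 : (b.factorial : ℝ) ≠ 0 := by positivity
  have f3 : (m.factorial : ℝ) ≠ 0 := by positivity
  field_simp

/-- The double series that arises from the product of two Bessel series. -/
theorem hasSum_pow_mul_pow_mul_Gamma {β : ℝ} (hβ : -1 / 2 ≤ β) (X Y : ℝ) :
    HasSum (fun i : ℕ × ℕ => X ^ i.1 * Y ^ i.2 * (Real.Gamma (β + (i.1 + i.2 : ℕ) + 1) /
      ((i.1.factorial * Real.Gamma (β + i.1 + 1)) * (i.2.factorial * Real.Gamma (β + i.2 + 1)))))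
      (Real.exp X * Real.exp Y * besselSeries β (-(X * Y))) := by
  have hexp : ∀ x : ℝ, HasSum (fun n : ℕ => x ^ n / n.factorial) (Real.exp x) := fun x => by
    rw [Real.exp_eq_exp_ℝ]
    exact NormedSpace.expSeries_div_hasSum_exp x
  have hB := (summable_besselSeries hβ (-(X * Y))).hasSum
  have hXYB := ((hexp X).mul_real (hexp Y)).mul_real hB
  let G : (ℕ × ℕ) × ℕ → ℝ := fun i => X ^ i.1.1 * Y ^ i.1.2 *
    ((i.1.1.choose i.2 * i.1.2.choose i.2 * i.2.factorial : ℝ) / Real.Gamma (β + i.2 + 1)) /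
      (i.1.1.factorial * i.1.2.factorial)
  -- The triple product of the series of exp X, exp Y and the Bessel series is reindexed by (a, b,
  -- m) ↦ (a + m, b + m, m). Off the range of `e` a binomial coefficient vanishes, and the sum over
  -- m is the Chu–Vandermonde sum.
  let e : (ℕ × ℕ) × ℕ → (ℕ × ℕ) × ℕ := fun i => ((i.1.1 + i.2, i.1.2 + i.2), i.2)
  have he : Function.Injective e := by
    rintro ⟨⟨a, b⟩, m⟩ ⟨⟨a', b'⟩, m'⟩ h
    simp only [e, Prod.mk.injEq] at h ⊢
    omega
  have hG : HasSum G (Real.exp X * Real.exp Y * besselSeries β (-(X * Y))) := by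
    rw [← he.hasSum_iff]
    · convert! hXYB using 1
      ext ⟨⟨a, b⟩, m⟩
      simp only [Function.comp, G, e, neg_neg]
      rw [choose_div_factorial_mul_factorial]
      ring
    · rintro ⟨⟨k, l⟩, m⟩ h
      simp only [Set.mem_range, not_exists, e] at h
      simp only [G]
      by_cases hk : k < m
      · simp [Nat.choose_eq_zero_of_lt hk]
      by_cases hl : l < m
      · simp [Nat.choose_eq_zero_of_lt hl]
      exact absurd (by ext <;> simp <;> omega) (h ((k - m, l - m), m))
  have hfib : ∀ i : ℕ × ℕ, HasSum (fun m => G (i, m)) (X ^ i.1 * Y ^ i.2 *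
      (Real.Gamma (β + (i.1 + i.2 : ℕ) + 1) /
      ((i.1.factorial * Real.Gamma (β + i.1 + 1)) *
        (i.2.factorial * Real.Gamma (β + i.2 + 1))))) := by
    intro i
    have hz : ∀ m ∉ Finset.range (i.1 + 1), G (i, m) = 0 := fun m hm => by
      have : i.1 < m := by simpa using hm
      simp only [G, Nat.choose_eq_zero_of_lt this, Nat.cast_zero, zero_mul, zero_div, mul_zero]
    have hfin : HasSum (fun m => G (i, m)) (∑ m ∈ Finset.range (i.1 + 1), G (i, m)) :=
      hasSum_sum_of_ne_finset_zero hz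
    convert! hfin using 1
    simp only [G]
    rw [← Finset.sum_div, ← Finset.mul_sum,
      sum_choose_mul_choose_div_Gamma i.1 i.2 (show -1 < β by linarith)]
    field_simp
  exact hG.prod_fiberwise hfib

theorem integrableOn_rpow_mul_exp_neg_mul_sq_add {β t : ℝ} (hβ : -1 / 2 ≤ β) (ht : 0 < t) (n : ℕ) :
    IntegrableOn (fun r : ℝ => (r ^ 2) ^ n * (r ^ (2 * β + 1) * Real.exp (-t * r ^ 2)))
      (Set.Ioi 0) := by
  have hn : (0 : ℝ) ≤ n := by positivity
  refine (integrableOn_rpow_mul_exp_neg_mul_sq ht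
    (s := 2 * β + 1 + (2 * n : ℕ)) (by push_cast; linarith)).congr_fun ?_ measurableSet_Ioi
  intro r hr
  simp only
  rw [Real.rpow_add_natCast (ne_of_gt hr), ← pow_mul]
  ring

theorem integral_rpow_mul_exp_neg_mul_sq_add {β t : ℝ} (hβ : -1 / 2 ≤ β) (ht : 0 < t) (n : ℕ) :
    ∫ r in Set.Ioi (0 : ℝ), (r ^ 2) ^ n * (r ^ (2 * β + 1) * Real.exp (-t * r ^ 2)) =
      1 / 2 * t ^ (-(β + 1)) * (Real.Gamma (β + n + 1) / t ^ n) := by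
  have hn : (0 : ℝ) ≤ n := by positivity
  have h := integral_rpow_mul_exp_neg_mul_rpow (p := 2) (q := 2 * β + 1 + (2 * n : ℕ))
    two_pos (by push_cast; linarith) ht
  rw [show -(2 * β + 1 + ((2 * n : ℕ) : ℝ) + 1) / 2 = -(β + 1) - n by push_cast; ring,
    show (2 * β + 1 + ((2 * n : ℕ) : ℝ) + 1) / 2 = β + n + 1 by push_cast; ring,
    Real.rpow_sub_natCast ht.ne'] at h
  rw [show 1 / 2 * t ^ (-(β + 1)) * (Real.Gamma (β + n + 1) / t ^ n) =
    t ^ (-(β + 1)) / t ^ n * (1 / 2) * Real.Gamma (β + n + 1) by ring, ← h]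
  refine setIntegral_congr_fun measurableSet_Ioi fun r hr => ?_
  rw [Real.rpow_add_natCast (ne_of_gt hr), ← pow_mul, Real.rpow_two]
  ring

/-- Weber's second exponential integral. -/
theorem integral_besselSeries_mul_besselSeries {β t : ℝ} (hβ : -1 / 2 ≤ β) (ht : 0 < t)
    (A B : ℝ) :
    ∫ r in Set.Ioi (0 : ℝ), besselSeries β (A * r ^ 2) * besselSeries β (B * r ^ 2) *
        (r ^ (2 * β + 1) * Real.exp (-t * r ^ 2)) =
      1 / 2 * t ^ (-(β + 1)) * (Real.exp (-(A / t)) * Real.exp (-(B / t)) *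
        besselSeries β (-(A / t * (B / t)))) := by
  let c : ℕ → ℝ := fun k => k.factorial * Real.Gamma (β + k + 1)
  let F : ℕ × ℕ → ℝ → ℝ := fun i r => (-A) ^ i.1 * (-B) ^ i.2 / (c i.1 * c i.2) *
    ((r ^ 2) ^ (i.1 + i.2) * (r ^ (2 * β + 1) * Real.exp (-t * r ^ 2)))
  have hint : ∀ i, Integrable (F i) (volume.restrict (Set.Ioi 0)) := fun i =>
    (integrableOn_rpow_mul_exp_neg_mul_sq_add hβ ht (i.1 + i.2)).const_mul _
  have hval : ∀ i : ℕ × ℕ, ∀ a b : ℝ, a ^ i.1 * b ^ i.2 / (c i.1 * c i.2) *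
      (1 / 2 * t ^ (-(β + 1)) * (Real.Gamma (β + (i.1 + i.2 : ℕ) + 1) / t ^ (i.1 + i.2))) =
      1 / 2 * t ^ (-(β + 1)) * ((a / t) ^ i.1 * (b / t) ^ i.2 *
        (Real.Gamma (β + (i.1 + i.2 : ℕ) + 1) / (c i.1 * c i.2))) := by
    intro i a b
    rw [div_pow, div_pow, pow_add]
    ring
  -- Termwise integration is justified by the same double series with |A|/t and |B|/t in place of
  -- -A/t and -B/t.
  have hsum : Summable fun i => ∫ r in Set.Ioi (0 : ℝ), ‖F i r‖ := by
    have := (hasSum_pow_mul_pow_mul_Gamma hβ (|A| / t) (|B| / t)).summable.norm.mul_left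
      (1 / 2 * t ^ (-(β + 1)))
    refine this.congr fun i => ?_
    have hc : ∀ k, 0 < c k := fun k => by
      have : (0 : ℝ) ≤ k := by positivity
      have := Real.Gamma_pos_of_pos (show 0 < β + k + 1 by linarith)
      positivity
    have e1 : ∫ r in Set.Ioi (0 : ℝ), ‖F i r‖ = |A| ^ i.1 * |B| ^ i.2 / (c i.1 * c i.2) *
        (1 / 2 * t ^ (-(β + 1)) * (Real.Gamma (β + (i.1 + i.2 : ℕ) + 1) / t ^ (i.1 + i.2))) := by
      rw [← integral_rpow_mul_exp_neg_mul_sq_add hβ ht, ← integral_const_mul]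
      refine setIntegral_congr_fun measurableSet_Ioi fun r hr => ?_
      have hr' : 0 ≤ (r ^ 2) ^ (i.1 + i.2) * (r ^ (2 * β + 1) * Real.exp (-t * r ^ 2)) := by
        have : 0 ≤ r ^ (2 * β + 1) := Real.rpow_nonneg (le_of_lt hr) _
        positivity
      have h1 := hc i.1
      have h2 := hc i.2
      simp only [F]
      rw [norm_mul, Real.norm_of_nonneg hr', norm_div, norm_mul, norm_pow, norm_pow, norm_neg,
        norm_neg, Real.norm_of_nonneg (mul_pos h1 h2).le, Real.norm_eq_abs, Real.norm_eq_abs]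
    rw [e1, hval, Real.norm_of_nonneg]
    have := Real.Gamma_pos_of_pos (show 0 < β + (i.1 + i.2 : ℕ) + 1 by
      have : (0 : ℝ) ≤ (i.1 + i.2 : ℕ) := by positivity
      linarith)
    have h1 := hc i.1
    have h2 := hc i.2
    have h3 : 0 < Real.Gamma (β + (i.1 + i.2 : ℕ) + 1) / (c i.1 * c i.2) := by positivity
    exact mul_nonneg (by positivity) h3.le
  have h1 := hasSum_integral_of_summable_integral_norm hint hsum
  have h2 := (hasSum_pow_mul_pow_mul_Gamma hβ (-A / t) (-B / t)).mul_left
    (1 / 2 * t ^ (-(β + 1)))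
  have h3 : ∀ i, ∫ r in Set.Ioi (0 : ℝ), F i r = 1 / 2 * t ^ (-(β + 1)) *
      ((-A / t) ^ i.1 * (-B / t) ^ i.2 *
        (Real.Gamma (β + (i.1 + i.2 : ℕ) + 1) / (c i.1 * c i.2))) := by
    intro i
    rw [← hval, ← integral_rpow_mul_exp_neg_mul_sq_add hβ ht, ← integral_const_mul]
  simp only [h3] at h1
  have h4 := h1.unique h2
  rw [show -(-A / t * (-B / t)) = -(A / t * (B / t)) by ring, neg_div, neg_div] at h4
  rw [← h4]
  congr 1
  ext r
  have hs : ∀ D, Summable fun k : ℕ => (-(D * r ^ 2)) ^ k / c k := fun D =>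
    summable_besselSeries hβ (D * r ^ 2)
  have h5 := tsum_mul_tsum_of_summable_norm (hs A).norm (hs B).norm
  unfold besselSeries
  change (∑' k : ℕ, (-(A * r ^ 2)) ^ k / c k) * (∑' k : ℕ, (-(B * r ^ 2)) ^ k / c k) * _ = _
  rw [h5, ← tsum_mul_right]
  congr 1
  ext i
  simp only [F]
  rw [pow_add, ← neg_mul, ← neg_mul, mul_pow, mul_pow]
  ring

theorem besselSeries_neg_nonneg {β s : ℝ} (hβ : -1 < β) (hs : 0 ≤ s) :
    0 ≤ besselSeries β (-s) := by
  refine tsum_nonneg fun k => ?_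
  have : (0 : ℝ) ≤ k := by positivity
  have := Real.Gamma_pos_of_pos (show 0 < β + k + 1 by linarith)
  rw [neg_neg]
  positivity

/-- All terms are nonnegative, so Tonelli applies; each Gaussian moment cancels the Gamma factor in
its coefficient and leaves an exponential series. This supplies the mass of the Bessel heat kernel.
-/
theorem lintegral_besselSeries_neg {β t : ℝ} (hβ : -1 / 2 ≤ β) (ht : 0 < t) {A : ℝ} (hA : 0 ≤ A) :
    ∫⁻ r in Set.Ioi (0 : ℝ), ENNReal.ofReal (besselSeries β (-(A * r ^ 2)) *
        (r ^ (2 * β + 1) * Real.exp (-t * r ^ 2))) =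
      ENNReal.ofReal (1 / 2 * t ^ (-(β + 1)) * Real.exp (A / t)) := by
  let c : ℕ → ℝ := fun k => k.factorial * Real.Gamma (β + k + 1)
  let F : ℕ → ℝ → ℝ := fun k r => A ^ k / c k *
    ((r ^ 2) ^ k * (r ^ (2 * β + 1) * Real.exp (-t * r ^ 2)))
  have hG : ∀ k : ℕ, 0 < Real.Gamma (β + k + 1) := fun k => by
    have : (0 : ℝ) ≤ k := by positivity
    exact Real.Gamma_pos_of_pos (by linarith)
  have hc : ∀ k, 0 < c k := fun k => mul_pos (by positivity) (hG k)
  have hF : ∀ k, ∀ r ∈ Set.Ioi (0 : ℝ), 0 ≤ F k r := fun k r hr => by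
    have := hc k
    have : 0 ≤ r ^ (2 * β + 1) := Real.rpow_nonneg (le_of_lt hr) _
    positivity
  have hFs : ∀ r, HasSum (fun k => F k r) (besselSeries β (-(A * r ^ 2)) *
        (r ^ (2 * β + 1) * Real.exp (-t * r ^ 2))) := fun r => by
    convert! (summable_besselSeries hβ (-(A * r ^ 2))).hasSum.mul_right
      (r ^ (2 * β + 1) * Real.exp (-t * r ^ 2)) using 1
    ext k
    simp only [F, c]
    rw [neg_neg, mul_pow]
    ring
  have hmeas : ∀ k, Measurable (F k) := fun k => by fun_prop
  calc _ = ∫⁻ r in Set.Ioi (0 : ℝ), ∑' k, ENNReal.ofReal (F k r) := by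
        refine setLIntegral_congr_fun measurableSet_Ioi fun r hr => ?_
        rw [← (hFs r).tsum_eq, ENNReal.ofReal_tsum_of_nonneg (fun k => hF k r hr) (hFs r).summable]
    _ = ∑' k, ∫⁻ r in Set.Ioi (0 : ℝ), ENNReal.ofReal (F k r) :=
        lintegral_tsum fun k => (hmeas k).ennreal_ofReal.aemeasurable
    _ = ∑' k : ℕ, ENNReal.ofReal (1 / 2 * t ^ (-(β + 1)) * ((A / t) ^ k / k.factorial)) := by
        congr 1
        ext k
        rw [← ofReal_integral_eq_lintegral_ofReal
          ((integrableOn_rpow_mul_exp_neg_mul_sq_add hβ ht k).const_mul _)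
          ((ae_restrict_iff' measurableSet_Ioi).2 (Eventually.of_forall (hF k)))]
        rw [integral_const_mul, integral_rpow_mul_exp_neg_mul_sq_add hβ ht]
        congr 1
        simp only [c]
        have := hG k
        rw [div_pow]
        field_simp
    _ = _ := by
        have hexp : HasSum (fun n : ℕ => (A / t) ^ n / n.factorial) (Real.exp (A / t)) := by
          rw [Real.exp_eq_exp_ℝ]
          exact NormedSpace.expSeries_div_hasSum_exp _
        have := hexp.mul_left (1 / 2 * t ^ (-(β + 1)))
        rw [← this.tsum_eq, ENNReal.ofReal_tsum_of_nonneg _ this.summable]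
        intro k
        positivity

theorem ENNReal.two_mul_coe_mul_coe_le (a b : ℝ≥0) :
    2 * ((a : ℝ≥0∞) * b) ≤ (a : ℝ≥0∞) ^ 2 + (b : ℝ≥0∞) ^ 2 := by
  have := two_mul_le_add_sq a b
  rw [mul_assoc] at this
  exact_mod_cast this

/-! ### Schur's test and L²-contraction from a Gram kernel -/

section Kernel

variable {X : Type*} [MeasurableSpace X] {μ : Measure X} [SFinite μ]

/-- Schur's test with exponent `2` for a symmetric kernel of mass at most `1`. -/
theorem lintegral_enorm_mul_enorm_mul_le {K : X → X → ℝ≥0∞}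
    (hK : Measurable (Function.uncurry K)) (hsymm : ∀ x y, K x y = K y x)
    (hmass : ∀ x, ∫⁻ y, K x y ∂μ ≤ 1) {u : X → ℂ} (hu : AEStronglyMeasurable u μ) :
    ∫⁻ z, ‖u z.1‖ₑ * ‖u z.2‖ₑ * K z.1 z.2 ∂(μ.prod μ) ≤ ∫⁻ x, ‖u x‖ₑ ^ 2 ∂μ := by
  have hu1 : AEMeasurable (fun z : X × X => ‖u z.1‖ₑ ^ 2) (μ.prod μ) :=
    hu.comp_fst.enorm.pow_const 2
  have hu2 : AEMeasurable (fun z : X × X => ‖u z.2‖ₑ ^ 2) (μ.prod μ) :=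
    hu.comp_snd.enorm.pow_const 2
  have hK' : AEMeasurable (fun z : X × X => K z.1 z.2) (μ.prod μ) := hK.aemeasurable
  have hm1 : AEMeasurable (fun z : X × X => ‖u z.1‖ₑ ^ 2 * K z.1 z.2) (μ.prod μ) := hu1.mul hK'
  have hm2 : AEMeasurable (fun z : X × X => ‖u z.2‖ₑ ^ 2 * K z.1 z.2) (μ.prod μ) := hu2.mul hK'
  have h1 : ∫⁻ z, ‖u z.1‖ₑ ^ 2 * K z.1 z.2 ∂(μ.prod μ) ≤ ∫⁻ x, ‖u x‖ₑ ^ 2 ∂μ := by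
    rw [lintegral_prod _ hm1]
    refine lintegral_mono fun x => ?_
    simp only
    rw [lintegral_const_mul _ (hK.of_uncurry_left)]
    exact mul_le_of_le_one_right' (hmass x)
  have h2 : ∫⁻ z, ‖u z.2‖ₑ ^ 2 * K z.1 z.2 ∂(μ.prod μ) ≤ ∫⁻ x, ‖u x‖ₑ ^ 2 ∂μ := by
    rw [lintegral_prod_symm _ hm2]
    refine lintegral_mono fun x => ?_
    simp only [fun y => hsymm y x]
    rw [lintegral_const_mul _ (hK.of_uncurry_left)]
    exact mul_le_of_le_one_right' (hmass x)
  have h3 : 2 * ∫⁻ z, ‖u z.1‖ₑ * ‖u z.2‖ₑ * K z.1 z.2 ∂(μ.prod μ) ≤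
      2 * ∫⁻ x, ‖u x‖ₑ ^ 2 ∂μ := by
    rw [← lintegral_const_mul' _ _ (by simp), two_mul (∫⁻ x, ‖u x‖ₑ ^ 2 ∂μ)]
    refine le_trans ?_ (add_le_add h1 h2)
    rw [← lintegral_add_left' hm1]
    refine lintegral_mono fun z => ?_
    rw [← add_mul, ← mul_assoc]
    gcongr
    exact ENNReal.two_mul_coe_mul_coe_le _ _
  exact (ENNReal.mul_le_mul_iff_right (by simp) (by simp)).1 h3

/-- If the weighted Gram kernel of an integral operator with bounded kernel is a symmetric
nonnegative kernel of mass at most `1`, the operator is an `L²`-contraction for the weight. -/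
theorem lintegral_enorm_integral_sq_mul_le {Λ : X → X → ℂ}
    (hΛ : StronglyMeasurable (Function.uncurry Λ)) (hΛ1 : ∀ x l, ‖Λ x l‖ ≤ 1)
    {w : X → ℝ} (hw : Integrable w μ) (hw0 : ∀ l, 0 ≤ w l)
    {K : X → X → ℝ} (hK : Measurable (Function.uncurry K)) (hK0 : ∀ x y, 0 ≤ K x y)
    (hsymm : ∀ x y, K x y = K y x) (hmass : ∀ x, ∫⁻ y, ENNReal.ofReal (K x y) ∂μ ≤ 1)
    (hgram : ∀ x y, ∫ l, Λ x l * (starRingEnd ℂ) (Λ y l) * (w l : ℂ) ∂μ = (K x y : ℂ))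
    {u : X → ℂ} (hu : Integrable u μ) :
    ∫⁻ l, ‖∫ x, u x * Λ x l ∂μ‖ₑ ^ 2 * ENNReal.ofReal (w l) ∂μ ≤ ∫⁻ x, ‖u x‖ₑ ^ 2 ∂μ := by
  let c := starRingEnd ℂ
  let T : X → ℂ := fun l => ∫ x, u x * Λ x l ∂μ
  let H : X × X → X → ℂ := fun z l =>
    (Λ z.1 l * c (Λ z.2 l)) * ((u z.1 * c (u z.2)) * (w l : ℂ))
  have hcu : Integrable (fun x => c (u x)) μ := (Complex.conjCLE : ℂ →L[ℝ] ℂ).integrable_comp hu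
  have hH : Integrable (Function.uncurry H) ((μ.prod μ).prod μ) := by
    have h := (hu.mul_prod hcu).mul_prod (hw.ofReal (𝕜 := ℂ))
    refine h.bdd_mul (c := 1) (f := fun z : (X × X) × X => Λ z.1.1 z.2 * c (Λ z.1.2 z.2)) ?_ ?_
    · have m1 : StronglyMeasurable fun z : (X × X) × X => Λ z.1.1 z.2 :=
        hΛ.comp_measurable (g := fun z : (X × X) × X => (z.1.1, z.2)) (by fun_prop)
      have m2 : StronglyMeasurable fun z : (X × X) × X => Λ z.1.2 z.2 :=
        hΛ.comp_measurable (g := fun z : (X × X) × X => (z.1.2, z.2)) (by fun_prop)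
      exact (m1.mul m2.star).aestronglyMeasurable
    · refine Eventually.of_forall fun z => ?_
      rw [norm_mul, RCLike.norm_conj]
      exact mul_le_one₀ (hΛ1 _ _) (norm_nonneg _) (hΛ1 _ _)
  have hin : ∀ l, ∫ z, H z l ∂(μ.prod μ) = ((‖T l‖ ^ 2 * w l : ℝ) : ℂ) := by
    intro l
    have e1 : ∀ z : X × X, H z l = (u z.1 * Λ z.1 l) * c (u z.2 * Λ z.2 l) * (w l : ℂ) := by
      intro z
      simp only [H, map_mul]
      ring
    simp only [e1]
    rw [integral_mul_const, integral_prod_mul (fun x => u x * Λ x l) (fun x => c (u x * Λ x l)),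
      integral_conj]
    push_cast
    rw [← Complex.mul_conj']
  have hI : Integrable (fun l => ‖T l‖ ^ 2 * w l) μ := by
    have := hH.integral_prod_right.re
    refine this.congr (Eventually.of_forall fun l => ?_)
    change RCLike.re (∫ z, H z l ∂(μ.prod μ)) = _
    rw [hin]
    exact Complex.ofReal_re _
  -- Writing |T l|² as a double integral and applying Fubini puts the integral over l innermost,
  -- where it is the Gram kernel.
  have hswap : ((∫ l, ‖T l‖ ^ 2 * w l ∂μ : ℝ) : ℂ) =
      ∫ z, (u z.1 * c (u z.2)) * (K z.1 z.2 : ℂ) ∂(μ.prod μ) := by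
    rw [← integral_complex_ofReal]
    simp only [← hin]
    rw [← integral_integral_swap hH]
    congr 1
    ext z
    rw [← hgram, ← integral_const_mul]
    congr 1
    ext l
    simp only [H]
    ring
  have hnn : ∀ l, 0 ≤ ‖T l‖ ^ 2 * w l := fun l => mul_nonneg (sq_nonneg _) (hw0 l)
  calc ∫⁻ l, ‖T l‖ₑ ^ 2 * ENNReal.ofReal (w l) ∂μ
      = ∫⁻ l, ENNReal.ofReal (‖T l‖ ^ 2 * w l) ∂μ := by
        congr 1
        ext l
        rw [ENNReal.ofReal_mul (sq_nonneg _), ENNReal.ofReal_pow (norm_nonneg _),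
          ofReal_norm]
    _ = ENNReal.ofReal (∫ l, ‖T l‖ ^ 2 * w l ∂μ) :=
        (ofReal_integral_eq_lintegral_ofReal hI (Eventually.of_forall hnn)).symm
    _ = ‖((∫ l, ‖T l‖ ^ 2 * w l ∂μ : ℝ) : ℂ)‖ₑ := by
        rw [← ofReal_norm, Complex.norm_real,
          Real.norm_of_nonneg (integral_nonneg hnn)]
    _ ≤ ∫⁻ z, ‖u z.1‖ₑ * ‖u z.2‖ₑ * ENNReal.ofReal (K z.1 z.2) ∂(μ.prod μ) := by
        rw [hswap]
        refine (enorm_integral_le_lintegral_enorm _).trans (le_of_eq ?_)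
        congr 1
        ext z
        rw [enorm_mul, enorm_mul]
        congr 1
        · congr 1
          exact RCLike.enorm_conj _
        · rw [← ofReal_norm, Complex.norm_real, Real.norm_of_nonneg (hK0 _ _)]
    _ ≤ _ := lintegral_enorm_mul_enorm_mul_le (K := fun x y => ENNReal.ofReal (K x y))
        hK.ennreal_ofReal (fun x y => by rw [hsymm]) hmass hu.aestronglyMeasurable

end Kernel

/-! ### The Weinstein measure and the heat kernels -/

/-- The measure `κ r^{2α+1} dr` on `(0, ∞)`. -/
noncomputable def radialMeasure (α κ : ℝ) : Measure ℝ :=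
  (volume.restrict (Set.Ioi 0)).withDensity (fun r => ENNReal.ofReal (κ * r ^ (2 * α + 1)))

instance (α κ : ℝ) : SigmaFinite (radialMeasure α κ) :=
  SigmaFinite.withDensity_of_ne_top (by simp)

theorem weinsteinMeasure_eq_prod (d : ℕ) (α κ : ℝ) :
    weinsteinMeasure d α κ =
      (volume : Measure (EuclideanSpace ℝ (Fin d))).prod (radialMeasure α κ) := by
  have h : halfSpace d = Set.univ ×ˢ Set.Ioi (0 : ℝ) := by
    ext x
    simp [halfSpace]
  rw [weinsteinMeasure, radialMeasure, prod_withDensity_right (by fun_prop), h,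
    Measure.volume_eq_prod, ← Measure.prod_restrict, Measure.restrict_univ]

instance (d : ℕ) (α κ : ℝ) : SigmaFinite (weinsteinMeasure d α κ) := by
  rw [weinsteinMeasure_eq_prod]
  infer_instance

theorem integral_radialMeasure (α : ℝ) {κ : ℝ} (hκ : 0 ≤ κ) {E : Type*} [NormedAddCommGroup E]
    [NormedSpace ℝ E] (f : ℝ → E) :
    ∫ r, f r ∂(radialMeasure α κ) = ∫ r in Set.Ioi 0, (κ * r ^ (2 * α + 1)) • f r := by
  rw [radialMeasure, integral_withDensity_eq_integral_toReal_smul (by fun_prop) (by simp)]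
  refine setIntegral_congr_fun measurableSet_Ioi fun r hr => ?_
  rw [ENNReal.toReal_ofReal (mul_nonneg hκ (Real.rpow_nonneg (le_of_lt hr) _))]

theorem lintegral_radialMeasure (α κ : ℝ) {f : ℝ → ℝ≥0∞} (hf : Measurable f) :
    ∫⁻ r, f r ∂(radialMeasure α κ) =
      ∫⁻ r in Set.Ioi 0, ENNReal.ofReal (κ * r ^ (2 * α + 1)) * f r := by
  rw [radialMeasure, lintegral_withDensity_eq_lintegral_mul _ (by fun_prop) hf]
  rfl

/-- The Gaussian weight. -/
noncomputable def gaussWeight (d : ℕ) (t : ℝ) (l : WSpace d) : ℝ :=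
  Real.exp (-t * ‖l.1‖ ^ 2) * Real.exp (-t * l.2 ^ 2)

theorem integrable_exp_neg_mul_norm_sq (d : ℕ) {t : ℝ} (ht : 0 < t) :
    Integrable (fun v : EuclideanSpace ℝ (Fin d) => Real.exp (-t * ‖v‖ ^ 2)) := by
  -- A non-integrable function would have integral 0 by convention, but the Gaussian integral is
  -- positive.
  by_contra h
  have h1 := GaussianFourier.integral_rexp_neg_mul_sq_norm (V := EuclideanSpace ℝ (Fin d)) ht
  rw [integral_undef h] at h1
  have : 0 < (Real.pi / t) ^ (Module.finrank ℝ (EuclideanSpace ℝ (Fin d)) / 2 : ℝ) := by positivity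
  linarith

theorem integrable_exp_neg_mul_sq_radialMeasure {α κ t : ℝ} (hα : -1 / 2 ≤ α) (hκ : 0 ≤ κ)
    (ht : 0 < t) : Integrable (fun r => Real.exp (-t * r ^ 2)) (radialMeasure α κ) := by
  rw [radialMeasure, integrable_withDensity_iff (by fun_prop) (by simp)]
  have h : IntegrableOn (fun r : ℝ => κ * ((r ^ 2) ^ 0 *
      (r ^ (2 * α + 1) * Real.exp (-t * r ^ 2)))) (Set.Ioi 0) :=
    (integrableOn_rpow_mul_exp_neg_mul_sq_add hα ht 0).const_mul κ
  refine h.congr_fun ?_ measurableSet_Ioi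
  intro r hr
  simp only
  rw [ENNReal.toReal_ofReal (mul_nonneg hκ (Real.rpow_nonneg (le_of_lt hr) _))]
  ring

theorem integrable_gaussWeight (d : ℕ) {α κ t : ℝ} (hα : -1 / 2 ≤ α) (hκ : 0 ≤ κ) (ht : 0 < t) :
    Integrable (gaussWeight d t) (weinsteinMeasure d α κ) := by
  rw [weinsteinMeasure_eq_prod]
  exact (integrable_exp_neg_mul_norm_sq d ht).mul_prod
    (integrable_exp_neg_mul_sq_radialMeasure hα hκ ht)

/-- The heat kernel of `ℝ^d`, up to normalization. -/
noncomputable def euclideanHeatKernel (d : ℕ) (t : ℝ) (x y : EuclideanSpace ℝ (Fin d)) : ℝ :=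
  (Real.pi / t) ^ ((d : ℝ) / 2) * Real.exp (-(1 / (4 * t)) * ‖x - y‖ ^ 2)

/-- The heat kernel of the Bessel operator, up to normalization. -/
noncomputable def besselHeatKernel (α κ t x y : ℝ) : ℝ :=
  κ / 2 * t ^ (-(α + 1)) * Real.Gamma (α + 1) ^ 2 *
    (Real.exp (-(x ^ 2 / 4 / t)) * Real.exp (-(y ^ 2 / 4 / t)) *
      besselSeries α (-(x ^ 2 / 4 / t * (y ^ 2 / 4 / t))))

theorem integral_cexp_mul_conj_mul_exp (d : ℕ) {t : ℝ} (ht : 0 < t)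
    (x y : EuclideanSpace ℝ (Fin d)) :
    ∫ v : EuclideanSpace ℝ (Fin d), Complex.exp (-Complex.I * ((inner ℝ x v : ℝ) : ℂ)) *
        (starRingEnd ℂ) (Complex.exp (-Complex.I * ((inner ℝ y v : ℝ) : ℂ))) *
        ((Real.exp (-t * ‖v‖ ^ 2) : ℝ) : ℂ) = (euclideanHeatKernel d t x y : ℂ) := by
  have h := GaussianFourier.integral_cexp_neg_mul_sq_norm_add (b := (t : ℂ)) (by simpa using ht)
    (-Complex.I) (x - y)
  rw [euclideanHeatKernel]
  push_cast
  rw [Complex.ofReal_cpow (by positivity)]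
  convert h using 1
  · congr 1
    ext v
    rw [← Complex.exp_conj, ← Complex.exp_add, ← Complex.exp_add, inner_sub_left]
    congr 1
    simp
    ring
  · congr 1
    · simp
    · congr 1
      rw [neg_sq, Complex.I_sq]
      have : (t : ℂ) ≠ 0 := by exact_mod_cast ht.ne'
      field_simp

theorem integral_besselJ_mul_besselJ {α κ t : ℝ} (hα : -1 / 2 ≤ α) (hκ : 0 ≤ κ) (ht : 0 < t)
    (x y : ℝ) :
    ∫ r, besselJ α (x * r) * besselJ α (y * r) * Real.exp (-t * r ^ 2) ∂(radialMeasure α κ) =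
      besselHeatKernel α κ t x y := by
  have h := integral_besselSeries_mul_besselSeries hα ht (x ^ 2 / 4) (y ^ 2 / 4)
  rw [integral_radialMeasure _ hκ, besselHeatKernel,
    show ∀ a : ℝ, κ / 2 * t ^ (-(α + 1)) * Real.Gamma (α + 1) ^ 2 * a =
      (κ * Real.Gamma (α + 1) ^ 2) * (1 / 2 * t ^ (-(α + 1)) * a) by intro a; ring,
    ← h, ← integral_const_mul]
  congr 1
  ext r
  rw [besselJ_eq, besselJ_eq, smul_eq_mul, show (x * r) ^ 2 / 4 = x ^ 2 / 4 * r ^ 2 by ring,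
    show (y * r) ^ 2 / 4 = y ^ 2 / 4 * r ^ 2 by ring]
  ring

theorem integral_weinsteinKernel_mul_conj (d : ℕ) {α κ t : ℝ} (hα : -1 / 2 ≤ α) (hκ : 0 ≤ κ)
    (ht : 0 < t) (x y : WSpace d) :
    ∫ l, weinsteinKernel d α x l * (starRingEnd ℂ) (weinsteinKernel d α y l) *
        (gaussWeight d t l : ℂ) ∂(weinsteinMeasure d α κ) =
      ((euclideanHeatKernel d t x.1 y.1 * besselHeatKernel α κ t x.2 y.2 : ℝ) : ℂ) := by
  rw [weinsteinMeasure_eq_prod]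
  push_cast
  rw [← integral_cexp_mul_conj_mul_exp d ht, ← integral_besselJ_mul_besselJ hα hκ ht,
    ← integral_complex_ofReal, ← integral_prod_mul]
  congr 1
  ext l
  simp only [weinsteinKernel, gaussWeight, map_mul, Complex.conj_ofReal]
  push_cast
  ring

/-- The Gaussian integral in y contributes (4πt)^{d/2}, so t cancels against the prefactor
(π/t)^{d/2}. -/
theorem lintegral_euclideanHeatKernel (d : ℕ) {t : ℝ} (ht : 0 < t)
    (x : EuclideanSpace ℝ (Fin d)) :
    ∫⁻ y, ENNReal.ofReal (euclideanHeatKernel d t x y) =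
      ENNReal.ofReal (((2 * Real.pi) ^ ((d : ℝ) / 2)) ^ 2) := by
  have ht' : 0 < 1 / (4 * t) := by positivity
  have hi := ((integrable_exp_neg_mul_norm_sq d ht').comp_sub_left x).const_mul
    ((Real.pi / t) ^ ((d : ℝ) / 2))
  unfold euclideanHeatKernel
  rw [← ofReal_integral_eq_lintegral_ofReal hi
    (Eventually.of_forall fun y => by simp only [Pi.zero_apply]; positivity)]
  congr 1
  rw [integral_const_mul,
    integral_sub_left_eq_self (fun v : EuclideanSpace ℝ (Fin d) =>
      Real.exp (-(1 / (4 * t)) * ‖v‖ ^ 2)),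
    GaussianFourier.integral_rexp_neg_mul_sq_norm ht', finrank_euclideanSpace_fin, ← Real.mul_rpow
      (by positivity) (by positivity), ← Real.rpow_mul_natCast (by positivity), mul_comm ((d : ℝ) / 2),
    Real.rpow_mul (by positivity)]
  congr 1
  simp
  field_simp
  norm_num

theorem besselHeatKernel_nonneg {α κ t : ℝ} (hα : -1 / 2 ≤ α) (hκ : 0 ≤ κ) (ht : 0 < t)
    (x y : ℝ) : 0 ≤ besselHeatKernel α κ t x y := by
  have := besselSeries_neg_nonneg (β := α) (s := x ^ 2 / 4 / t * (y ^ 2 / 4 / t))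
    (by linarith) (by positivity)
  unfold besselHeatKernel
  positivity

theorem continuous_besselHeatKernel {α : ℝ} (hα : -1 / 2 ≤ α) (κ t : ℝ) :
    Continuous (fun z : ℝ × ℝ => besselHeatKernel α κ t z.1 z.2) := by
  have : Continuous (besselSeries α) :=
    continuous_iff_continuousAt.2 fun s => (hasDerivAt_besselSeries hα s).continuousAt
  unfold besselHeatKernel
  fun_prop

/-- Here `lintegral_besselSeries_neg` is used with 1/(4t) in place of t. The factor exp(x²/(4t)) it
produces cancels the kernel's Gaussian in x, and the powers of t combine to 4^{α+1}, so the mass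
depends on neither x nor t. -/
theorem lintegral_besselHeatKernel {α κ t : ℝ} (hα : -1 / 2 ≤ α) (hκ : 0 ≤ κ) (ht : 0 < t)
    (x : ℝ) :
    ∫⁻ y, ENNReal.ofReal (besselHeatKernel α κ t x y) ∂(radialMeasure α κ) =
      ENNReal.ofReal ((κ * ((2 : ℝ) ^ α * Real.Gamma (α + 1))) ^ 2) := by
  have hG : 0 < Real.Gamma (α + 1) := Real.Gamma_pos_of_pos (by linarith)
  have hA : 0 ≤ x ^ 2 / (16 * t ^ 2) := by positivity
  have hm : Measurable fun y => ENNReal.ofReal (besselHeatKernel α κ t x y) :=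
    ((continuous_besselHeatKernel hα κ t).comp (Continuous.prodMk_right x)).measurable.ennreal_ofReal
  have h := lintegral_besselSeries_neg hα (show 0 < 1 / (4 * t) by positivity) hA
  -- One factor κ comes from the kernel, the other from the measure.
  set D : ℝ := κ ^ 2 / 2 * t ^ (-(α + 1)) * Real.Gamma (α + 1) ^ 2 * Real.exp (-(x ^ 2 / 4 / t))
    with hD
  have hD0 : 0 ≤ D := by positivity
  calc _ = ENNReal.ofReal D * ∫⁻ r in Set.Ioi (0 : ℝ), ENNReal.ofReal
        (besselSeries α (-(x ^ 2 / (16 * t ^ 2) * r ^ 2)) *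
          (r ^ (2 * α + 1) * Real.exp (-(1 / (4 * t)) * r ^ 2))) := by
        rw [lintegral_radialMeasure _ _ hm, ← lintegral_const_mul' _ _ ENNReal.ofReal_ne_top]
        refine setLIntegral_congr_fun measurableSet_Ioi fun r hr => ?_
        rw [← ENNReal.ofReal_mul (mul_nonneg hκ (Real.rpow_nonneg (le_of_lt hr) _)),
          ← ENNReal.ofReal_mul hD0, besselHeatKernel,
          show x ^ 2 / 4 / t * (r ^ 2 / 4 / t) = x ^ 2 / (16 * t ^ 2) * r ^ 2 by field_simp; ring,
          show -(1 / (4 * t)) * r ^ 2 = -(r ^ 2 / 4 / t) by field_simp]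
        congr 1
        rw [hD]
        ring
    _ = _ := by
        rw [h, ← ENNReal.ofReal_mul hD0]
        congr 1
        have e1 : x ^ 2 / (16 * t ^ 2) / (1 / (4 * t)) = x ^ 2 / 4 / t := by
          field_simp
          norm_num
        have e2 : Real.exp (-(x ^ 2 / 4 / t)) * Real.exp (x ^ 2 / 4 / t) = 1 := by
          rw [← Real.exp_add]
          simp
        have e3 : t ^ (-(α + 1)) * (1 / (4 * t)) ^ (-(α + 1)) = 4 * ((2 : ℝ) ^ α) ^ 2 := by
          rw [← Real.mul_rpow ht.le (by positivity), show t * (1 / (4 * t)) = 4⁻¹ by field_simp,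
            Real.inv_rpow (by norm_num), Real.rpow_neg (by norm_num), inv_inv,
            Real.rpow_add_one (by norm_num), ← Real.rpow_mul_natCast (by norm_num),
            mul_comm α, Real.rpow_mul (by norm_num)]
          norm_num
          ring
        rw [e1, hD]
        linear_combination (κ ^ 2 / 4 * Real.Gamma (α + 1) ^ 2 * 4 * ((2 : ℝ) ^ α) ^ 2) * e2 +
          (κ ^ 2 / 4 * Real.Gamma (α + 1) ^ 2 * Real.exp (-(x ^ 2 / 4 / t)) *
            Real.exp (x ^ 2 / 4 / t)) * e3

theorem norm_weinsteinKernel_le_one (d : ℕ) {α : ℝ} (hα : -1 / 2 ≤ α) (x l : WSpace d) :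
    ‖weinsteinKernel d α x l‖ ≤ 1 := by
  rw [weinsteinKernel, norm_mul, Complex.norm_real, Real.norm_eq_abs, Complex.norm_exp]
  simpa using abs_besselJ_le_one hα _

theorem continuous_weinsteinKernel (d : ℕ) {α : ℝ} (hα : -1 / 2 ≤ α) :
    Continuous (Function.uncurry (weinsteinKernel d α)) := by
  have := continuous_besselJ hα
  unfold weinsteinKernel Function.uncurry
  fun_prop

/-! ### The L²-bound for the Weinstein integral -/

section Integral

variable {d : ℕ} {α κ : ℝ} {u : WSpace d → ℂ}

theorem continuous_weinsteinIntegral (hα : -1 / 2 ≤ α)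
    (hu : Integrable u (weinsteinMeasure d α κ)) : Continuous (weinsteinIntegral d α κ u) := by
  have hc := continuous_weinsteinKernel d hα
  have h1 : ∀ l, Continuous fun x => weinsteinKernel d α x l := fun l =>
    hc.comp (f := fun x => (x, l)) (by fun_prop)
  have h2 : ∀ x, Continuous fun l => weinsteinKernel d α x l := fun x =>
    hc.comp (f := fun l => (x, l)) (by fun_prop)
  unfold weinsteinIntegral
  refine continuous_of_dominated (F := fun l x => u x * weinsteinKernel d α x l)
    (μ := weinsteinMeasure d α κ) (bound := fun x => ‖u x‖) (fun l => ?_) (fun l => ?_) hu.norm ?_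
  · exact hu.aestronglyMeasurable.mul (h1 l).aestronglyMeasurable
  · refine Eventually.of_forall fun x => ?_
    rw [norm_mul]
    exact mul_le_of_le_one_right (norm_nonneg _) (norm_weinsteinKernel_le_one d hα x l)
  · exact Eventually.of_forall fun x => continuous_const.mul (h2 x)

/-- The Gaussian weight makes the Gram kernel an absolutely convergent integral; since the resulting
bound is uniform in t, Fatou's lemma along t = 1/(n + 1) removes the weight. -/
theorem lintegral_enorm_weinsteinIntegral_sq_le (hα : -1 / 2 ≤ α) (hκ : 0 ≤ κ)
    (hκ1 : κ ≤ weinsteinConst d α) (hu : Integrable u (weinsteinMeasure d α κ)) :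
    ∫⁻ l, ‖weinsteinIntegral d α κ u l‖ₑ ^ 2 ∂(weinsteinMeasure d α κ) ≤
      ∫⁻ x, ‖u x‖ₑ ^ 2 ∂(weinsteinMeasure d α κ) := by
  have hG : 0 < Real.Gamma (α + 1) := Real.Gamma_pos_of_pos (by linarith)
  have hw : ∀ t : ℝ, 0 < t →
      ∫⁻ l, ‖weinsteinIntegral d α κ u l‖ₑ ^ 2 * ENNReal.ofReal (gaussWeight d t l)
        ∂(weinsteinMeasure d α κ) ≤ ∫⁻ x, ‖u x‖ₑ ^ 2 ∂(weinsteinMeasure d α κ) := by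
    intro t ht
    have he : ∀ x y, 0 ≤ euclideanHeatKernel d t x y := fun x y => by
      unfold euclideanHeatKernel
      positivity
    have hec : Continuous fun z : EuclideanSpace ℝ (Fin d) × EuclideanSpace ℝ (Fin d) =>
        euclideanHeatKernel d t z.1 z.2 := by
      unfold euclideanHeatKernel
      fun_prop
    have hbc := continuous_besselHeatKernel hα κ t
    have hK : Continuous (Function.uncurry fun x y : WSpace d =>
        euclideanHeatKernel d t x.1 y.1 * besselHeatKernel α κ t x.2 y.2) :=
      (hec.comp (f := fun z : WSpace d × WSpace d => (z.1.1, z.2.1)) (by fun_prop)).mul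
        (hbc.comp (f := fun z : WSpace d × WSpace d => (z.1.2, z.2.2)) (by fun_prop))
    refine lintegral_enorm_integral_sq_mul_le
      (continuous_weinsteinKernel d hα).stronglyMeasurable (norm_weinsteinKernel_le_one d hα)
      (integrable_gaussWeight d hα hκ ht) (fun l => by unfold gaussWeight; positivity)
      (K := fun x y => euclideanHeatKernel d t x.1 y.1 * besselHeatKernel α κ t x.2 y.2)
      hK.measurable (fun x y => mul_nonneg (he _ _) (besselHeatKernel_nonneg hα hκ ht _ _))
      (fun x y => ?_) (fun x => ?_) (integral_weinsteinKernel_mul_conj d hα hκ ht) hu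
    · simp only [euclideanHeatKernel, besselHeatKernel, norm_sub_rev x.1 y.1,
        mul_comm (x.2 ^ 2 / 4 / t), mul_comm (Real.exp (-(x.2 ^ 2 / 4 / t)))]
    · rw [weinsteinMeasure_eq_prod]
      simp only [ENNReal.ofReal_mul (he _ _)]
      rw [lintegral_prod_mul (f := fun y => ENNReal.ofReal (euclideanHeatKernel d t x.1 y))
        (g := fun y => ENNReal.ofReal (besselHeatKernel α κ t x.2 y))
        (hec.comp (Continuous.prodMk_right x.1)).measurable.ennreal_ofReal.aemeasurable
        (hbc.comp (Continuous.prodMk_right x.2)).measurable.ennreal_ofReal.aemeasurable,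
        lintegral_euclideanHeatKernel d ht, lintegral_besselHeatKernel hα hκ ht,
        ← ENNReal.ofReal_mul (sq_nonneg _), ← mul_pow, ENNReal.ofReal_le_one]
      -- The mass is the square of κ / c_{d,α}.
      apply pow_le_one₀ (by positivity)
      rw [weinsteinConst, le_div_iff₀ (by positivity)] at hκ1
      linarith
  have hcont := continuous_weinsteinIntegral hα hu
  let s : ℕ → ℝ := fun n => 1 / ((n : ℝ) + 1)
  have hs : Tendsto s atTop (𝓝 0) := tendsto_one_div_add_atTop_nhds_zero_nat
  have hlim : ∀ l, Tendsto (fun n => ‖weinsteinIntegral d α κ u l‖ₑ ^ 2 *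
      ENNReal.ofReal (gaussWeight d (s n) l)) atTop (𝓝 (‖weinsteinIntegral d α κ u l‖ₑ ^ 2)) := by
    intro l
    have h1 : Continuous fun t => gaussWeight d t l := by
      unfold gaussWeight
      fun_prop
    have h2 := ENNReal.tendsto_ofReal ((h1.tendsto 0).comp hs)
    have h3 := ENNReal.Tendsto.const_mul (a := ‖weinsteinIntegral d α κ u l‖ₑ ^ 2) h2
      (Or.inr (by finiteness))
    simpa [gaussWeight] using h3
  calc _ = ∫⁻ l, liminf (fun n => ‖weinsteinIntegral d α κ u l‖ₑ ^ 2 *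
      ENNReal.ofReal (gaussWeight d (s n) l)) atTop ∂(weinsteinMeasure d α κ) := by
        congr 1
        ext l
        exact (hlim l).liminf_eq.symm
    _ ≤ liminf (fun n => ∫⁻ l, ‖weinsteinIntegral d α κ u l‖ₑ ^ 2 *
      ENNReal.ofReal (gaussWeight d (s n) l) ∂(weinsteinMeasure d α κ)) atTop := by
        refine lintegral_liminf_le fun n => ?_
        have : Continuous (gaussWeight d (s n)) := by
          unfold gaussWeight
          fun_prop
        exact (hcont.measurable.enorm.pow_const 2).mul this.measurable.ennreal_ofReal
    _ ≤ _ := by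
        refine liminf_le_of_le (by isBoundedDefault) fun b hb => ?_
        obtain ⟨n, hn⟩ := hb.exists
        exact hn.trans (hw (s n) (by simp only [s]; positivity))

end Integral

/-! ### Riesz–Thorin interpolation and the Hausdorff–Young inequality -/

section Interpolation

variable {X : Type*} [MeasurableSpace X]

/-- The integral operator with kernel `Λ`. -/
noncomputable def kernelIntegral (μ : Measure X) (Λ : X → X → ℂ) (u : X → ℂ) (l : X) : ℂ :=
  ∫ x, u x * Λ x l ∂μ

/-- The bilinear form of the integral operator with kernel `Λ`. -/
noncomputable def kernelPairing (μ : Measure X) (Λ : X → X → ℂ) (u v : X → ℂ) : ℂ :=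
  ∫ l, kernelIntegral μ Λ u l * v l ∂μ

variable {μ : Measure X} {Λ : X → X → ℂ}

theorem enorm_kernelIntegral_le (hΛ1 : ∀ x l, ‖Λ x l‖ ≤ 1) (u : X → ℂ) (l : X) :
    ‖kernelIntegral μ Λ u l‖ₑ ≤ eLpNorm u 1 μ := by
  rw [eLpNorm_one_eq_lintegral_enorm]
  refine (enorm_integral_le_lintegral_enorm _).trans (lintegral_mono fun x => ?_)
  rw [enorm_mul]
  refine mul_le_of_le_one_right' ?_
  rw [← ofReal_norm, ENNReal.ofReal_le_one]
  exact hΛ1 x l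

theorem enorm_kernelPairing_le (hΛ1 : ∀ x l, ‖Λ x l‖ ≤ 1) {u v : X → ℂ}
    (hv : AEStronglyMeasurable v μ) :
    ‖kernelPairing μ Λ u v‖ₑ ≤ eLpNorm u 1 μ * eLpNorm v 1 μ := by
  rw [eLpNorm_one_eq_lintegral_enorm (f := v), ← lintegral_const_mul'' _ hv.enorm]
  refine (enorm_integral_le_lintegral_enorm _).trans (lintegral_mono fun l => ?_)
  rw [enorm_mul]
  gcongr
  exact enorm_kernelIntegral_le hΛ1 u l

theorem stronglyMeasurable_kernelIntegral [SFinite μ]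
    (hΛ : StronglyMeasurable (Function.uncurry Λ)) {u : X → ℂ} (hu : AEStronglyMeasurable u μ) :
    StronglyMeasurable (kernelIntegral μ Λ u) := by
  have h : kernelIntegral μ Λ u = fun l => ∫ x, hu.mk u x * Λ x l ∂μ := by
    ext l
    refine integral_congr_ae ?_
    filter_upwards [hu.ae_eq_mk] with x hx
    rw [hx]
  rw [h]
  have h2 : StronglyMeasurable fun z : X × X => hu.mk u z.1 * Λ z.1 z.2 :=
    (hu.stronglyMeasurable_mk.comp_measurable measurable_fst).mul hΛ
  exact h2.integral_prod_left'

theorem integrable_mul_kernel (hΛ : StronglyMeasurable (Function.uncurry Λ))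
    (hΛ1 : ∀ x l, ‖Λ x l‖ ≤ 1) {u : X → ℂ} (hu : Integrable u μ) (l : X) :
    Integrable (fun x => u x * Λ x l) μ :=
  hu.mul_bdd (c := 1) (hΛ.of_uncurry_right).aestronglyMeasurable
    (Eventually.of_forall fun x => hΛ1 x l)

theorem norm_kernelIntegral_le (hΛ1 : ∀ x l, ‖Λ x l‖ ≤ 1) {u : X → ℂ} (hu : Integrable u μ)
    (l : X) : ‖kernelIntegral μ Λ u l‖ ≤ (eLpNorm u 1 μ).toReal := by
  rw [← toReal_enorm]
  exact ENNReal.toReal_mono (memLp_one_iff_integrable.2 hu).eLpNorm_ne_top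
    (enorm_kernelIntegral_le hΛ1 u l)

theorem integrable_kernelIntegral_mul [SFinite μ] (hΛ : StronglyMeasurable (Function.uncurry Λ))
    (hΛ1 : ∀ x l, ‖Λ x l‖ ≤ 1) {u v : X → ℂ} (hu : Integrable u μ) (hv : Integrable v μ) :
    Integrable (fun l => kernelIntegral μ Λ u l * v l) μ :=
  hv.bdd_mul (stronglyMeasurable_kernelIntegral hΛ hu.aestronglyMeasurable).aestronglyMeasurable
    (Eventually.of_forall fun l => norm_kernelIntegral_le hΛ1 hu l)

theorem kernelIntegral_sub (hΛ : StronglyMeasurable (Function.uncurry Λ))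
    (hΛ1 : ∀ x l, ‖Λ x l‖ ≤ 1) {u v : X → ℂ} (hu : Integrable u μ) (hv : Integrable v μ) :
    kernelIntegral μ Λ (u - v) = kernelIntegral μ Λ u - kernelIntegral μ Λ v := by
  ext l
  simp only [kernelIntegral, Pi.sub_apply, sub_mul]
  exact integral_sub (integrable_mul_kernel hΛ hΛ1 hu l) (integrable_mul_kernel hΛ hΛ1 hv l)

theorem enorm_kernelPairing_le_of_sq [SFinite μ] (hΛ : StronglyMeasurable (Function.uncurry Λ))
    (hL2 : ∀ u : X → ℂ, Integrable u μ →
      ∫⁻ l, ‖kernelIntegral μ Λ u l‖ₑ ^ 2 ∂μ ≤ ∫⁻ x, ‖u x‖ₑ ^ 2 ∂μ)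
    {u v : X → ℂ} (hu : Integrable u μ) (hv : Integrable v μ) :
    ‖kernelPairing μ Λ u v‖ₑ ≤
      (∫⁻ x, ‖u x‖ₑ ^ 2 ∂μ) ^ (1 / 2 : ℝ) * (∫⁻ x, ‖v x‖ₑ ^ 2 ∂μ) ^ (1 / 2 : ℝ) := by
  have h := ENNReal.lintegral_mul_le_Lp_mul_Lq μ Real.HolderConjugate.two_two
    (stronglyMeasurable_kernelIntegral hΛ hu.aestronglyMeasurable).enorm.aemeasurable
    hv.aestronglyMeasurable.enorm
  simp only [ENNReal.rpow_two] at h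
  refine (enorm_integral_le_lintegral_enorm _).trans ?_
  simp only [enorm_mul]
  exact h.trans (mul_le_mul' (ENNReal.rpow_le_rpow (hL2 u hu) (by norm_num)) le_rfl)

/-- The analytic family `z ↦ sgn(w) |w|^{p (1 - z/2)}`. -/
noncomputable def powerFamily (p : ℝ) (z w : ℂ) : ℂ :=
  if w = 0 then 0 else w / (‖w‖ : ℂ) * (‖w‖ : ℂ) ^ ((p : ℂ) * (1 - z / 2))

theorem powerFamily_zero (p : ℝ) (z : ℂ) : powerFamily p z 0 = 0 := by simp [powerFamily]

theorem norm_powerFamily {p : ℝ} {z w : ℂ} (hw : w ≠ 0) :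
    ‖powerFamily p z w‖ = ‖w‖ ^ (p * (1 - z.re / 2)) := by
  have hn : 0 < ‖w‖ := norm_pos_iff.2 hw
  rw [powerFamily, if_neg hw, norm_mul, norm_div, Complex.norm_real, norm_norm,
    div_self hn.ne', one_mul, Complex.norm_cpow_eq_rpow_re_of_pos hn]
  congr 1
  simp

theorem differentiable_powerFamily (p : ℝ) (w : ℂ) :
    Differentiable ℂ fun z => powerFamily p z w := by
  by_cases hw : w = 0
  · simp [powerFamily, hw]
  · have hn : (‖w‖ : ℂ) ≠ 0 := by simpa using hw
    simp only [powerFamily, hw, if_false]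
    intro z
    refine DifferentiableAt.const_mul (DifferentiableAt.const_cpow (by fun_prop) (Or.inl hn)) _

theorem norm_powerFamily_le {p : ℝ} (hp : 0 ≤ p) {z w : ℂ} (h0 : 0 ≤ z.re) (h1 : z.re ≤ 1) :
    ‖powerFamily p z w‖ ≤ (1 + ‖w‖) ^ p := by
  have hone : 1 ≤ 1 + ‖w‖ := by linarith [norm_nonneg w]
  by_cases hw : w = 0
  · rw [hw, powerFamily_zero]
    simp
  · rw [norm_powerFamily hw]
    calc ‖w‖ ^ (p * (1 - z.re / 2)) ≤ (1 + ‖w‖) ^ (p * (1 - z.re / 2)) :=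
          Real.rpow_le_rpow (norm_nonneg _) (by linarith) (mul_nonneg hp (by linarith))
      _ ≤ (1 + ‖w‖) ^ p := Real.rpow_le_rpow_of_exponent_le hone (by nlinarith)

theorem enorm_powerFamily_of_re_zero {p : ℝ} (hp : 0 < p) {z : ℂ} (hz : z.re = 0) (w : ℂ) :
    ‖powerFamily p z w‖ₑ = ‖w‖ₑ ^ p := by
  by_cases hw : w = 0
  · simp [hw, powerFamily_zero, hp]
  · rw [← ofReal_norm, norm_powerFamily hw, ← ofReal_norm,
      ENNReal.ofReal_rpow_of_nonneg (norm_nonneg _) hp.le, hz]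
    simp

theorem enorm_powerFamily_sq_of_re_one {p : ℝ} (hp : 0 < p) {z : ℂ} (hz : z.re = 1) (w : ℂ) :
    ‖powerFamily p z w‖ₑ ^ 2 = ‖w‖ₑ ^ p := by
  by_cases hw : w = 0
  · simp [hw, powerFamily_zero, hp]
  · rw [← ofReal_norm, norm_powerFamily hw, ← ofReal_norm,
      ENNReal.ofReal_rpow_of_nonneg (norm_nonneg _) hp.le, hz,
      ← ENNReal.ofReal_pow (by positivity), ← Real.rpow_mul_natCast (norm_nonneg _)]
    congr 2
    push_cast
    ring

/-- The point z = 2 - 2/p is the one at which the exponent p (1 - z/2) equals 1. -/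
theorem powerFamily_eq_self {p : ℝ} (hp : 0 < p) (w : ℂ) :
    powerFamily p ((2 - 2 / p : ℝ) : ℂ) w = w := by
  by_cases hw : w = 0
  · simp [hw, powerFamily_zero]
  · have hn : (‖w‖ : ℂ) ≠ 0 := by simpa using hw
    have hp' : (p : ℂ) ≠ 0 := by exact_mod_cast hp.ne'
    have : (p : ℂ) * (1 - ((2 - 2 / p : ℝ) : ℂ) / 2) = 1 := by
      push_cast
      field_simp
      ring
    rw [powerFamily, if_neg hw, this, Complex.cpow_one]
    field_simp

theorem comp_eq_sum_mul_indicator (s : SimpleFunc X ℂ) {g : ℂ → ℂ} (hg : g 0 = 0) (x : X) :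
    g (s x) = ∑ a ∈ s.range.filter (· ≠ 0), g a * (s ⁻¹' {a}).indicator 1 x := by
  by_cases h : s x = 0
  · rw [h, hg, Finset.sum_eq_zero]
    intro a ha
    have : s x ≠ a := by rw [h]; exact (Finset.mem_filter.1 ha).2.symm
    simp [this]
  · rw [Finset.sum_eq_single (s x)]
    · simp
    · intro a _ ha
      simp [ha.symm]
    · intro ha
      exact absurd (Finset.mem_filter.2 ⟨s.mem_range_self x, h⟩) ha

/-- Reduces the pairing along the analytic family to a finite sum of entire functions of z with
constant coefficients. The value 0 is left out because its fibre may have infinite measure. -/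
theorem kernelPairing_comp_simpleFunc [SFinite μ] (hΛ : StronglyMeasurable (Function.uncurry Λ))
    (hΛ1 : ∀ x l, ‖Λ x l‖ ≤ 1) {s t : SimpleFunc X ℂ} (hs : Integrable s μ) (ht : Integrable t μ)
    {g h : ℂ → ℂ} (hg : g 0 = 0) (hh : h 0 = 0) :
    kernelPairing μ Λ (fun x => g (s x)) (fun x => h (t x)) =
      ∑ a ∈ s.range.filter (· ≠ 0), ∑ b ∈ t.range.filter (· ≠ 0), g a * h b *
        kernelPairing μ Λ ((s ⁻¹' {a}).indicator 1) ((t ⁻¹' {b}).indicator 1) := by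
  have hind : ∀ r : SimpleFunc X ℂ, Integrable r μ → ∀ a ∈ r.range.filter (· ≠ 0),
      Integrable ((r ⁻¹' {a}).indicator (1 : X → ℂ)) μ := fun r hr a ha =>
    (integrable_indicator_iff (r.measurableSet_fiber a)).2 (integrableOn_const
      (SimpleFunc.integrable_iff.1 hr a (Finset.mem_filter.1 ha).2).ne)
  have hW : ∀ l, kernelIntegral μ Λ (fun x => g (s x)) l = ∑ a ∈ s.range.filter (· ≠ 0),
      g a * kernelIntegral μ Λ ((s ⁻¹' {a}).indicator 1) l := by
    intro l
    simp only [kernelIntegral, comp_eq_sum_mul_indicator s hg, Finset.sum_mul, mul_assoc]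
    rw [integral_finsetSum _ fun a ha =>
      (integrable_mul_kernel hΛ hΛ1 (hind s hs a ha) l).const_mul (g a)]
    simp only [integral_const_mul]
  simp only [kernelPairing, hW, comp_eq_sum_mul_indicator t hh, Finset.sum_mul_sum]
  have hint : ∀ a ∈ s.range.filter (· ≠ 0), ∀ b ∈ t.range.filter (· ≠ 0), Integrable (fun l =>
      g a * kernelIntegral μ Λ ((s ⁻¹' {a}).indicator 1) l *
        (h b * (t ⁻¹' {b}).indicator 1 l)) μ := by
    intro a ha b hb
    refine ((integrable_kernelIntegral_mul hΛ hΛ1 (hind s hs a ha)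
      (hind t ht b hb)).const_mul (g a * h b)).congr (Eventually.of_forall fun l => ?_)
    simp only
    ring
  rw [integral_finsetSum _ fun a ha => integrable_finsetSum _ (hint a ha)]
  refine Finset.sum_congr rfl fun a ha => ?_
  rw [integral_finsetSum _ (hint a ha)]
  refine Finset.sum_congr rfl fun b hb => ?_
  rw [← integral_const_mul]
  congr 1
  ext l
  ring

/-- The Riesz–Thorin interpolation step between `L¹ × L¹` and `L² × L²`, for simple functions. -/
theorem enorm_kernelPairing_simpleFunc_le [SFinite μ]
    (hΛ : StronglyMeasurable (Function.uncurry Λ)) (hΛ1 : ∀ x l, ‖Λ x l‖ ≤ 1)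
    (hL2 : ∀ u : X → ℂ, Integrable u μ →
      ∫⁻ l, ‖kernelIntegral μ Λ u l‖ₑ ^ 2 ∂μ ≤ ∫⁻ x, ‖u x‖ₑ ^ 2 ∂μ)
    {p : ℝ} (hp1 : 1 ≤ p) (hp2 : p ≤ 2) {s t : SimpleFunc X ℂ} (hs : Integrable s μ)
    (ht : Integrable t μ) :
    ‖kernelPairing μ Λ s t‖ₑ ≤
      eLpNorm s (ENNReal.ofReal p) μ * eLpNorm t (ENNReal.ofReal p) μ := by
  have hp : 0 < p := by linarith
  have hp0 : ENNReal.ofReal p ≠ 0 := by simpa using hp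
  have hfin : ∀ r : SimpleFunc X ℂ, Integrable r μ → ∫⁻ x, ‖r x‖ₑ ^ p ∂μ ≠ ∞ := by
    intro r hr
    have h1 : MemLp r (ENNReal.ofReal p) μ :=
      (SimpleFunc.memLp_iff_integrable hp0 ENNReal.ofReal_ne_top).2 hr
    have h2 := lintegral_rpow_enorm_lt_top_of_eLpNorm_lt_top hp0 ENNReal.ofReal_ne_top h1.2
    rw [ENNReal.toReal_ofReal hp.le] at h2
    exact h2.ne
  have hmap : ∀ r : SimpleFunc X ℂ, Integrable r μ → ∀ z,
      Integrable (fun x => powerFamily p z (r x)) μ := by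
    intro r hr z
    have := (SimpleFunc.integrable_iff_finMeasSupp.1 hr).map (g := powerFamily p z)
      (powerFamily_zero p z)
    exact SimpleFunc.integrable_iff_finMeasSupp.2 this
  set E : ℝ≥0∞ := (∫⁻ x, ‖s x‖ₑ ^ p ∂μ) * ∫⁻ x, ‖t x‖ₑ ^ p ∂μ with hE
  have hEfin : E ≠ ∞ := ENNReal.mul_ne_top (hfin s hs) (hfin t ht)
  let F : ℂ → ℂ := fun z =>
    kernelPairing μ Λ (fun x => powerFamily p z (s x)) (fun x => powerFamily p z (t x))
  have hF : F = fun z => ∑ a ∈ s.range.filter (· ≠ 0), ∑ b ∈ t.range.filter (· ≠ 0),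
      powerFamily p z a * powerFamily p z b *
        kernelPairing μ Λ ((s ⁻¹' {a}).indicator 1) ((t ⁻¹' {b}).indicator 1) := by
    ext z
    exact kernelPairing_comp_simpleFunc hΛ hΛ1 hs ht (powerFamily_zero p z) (powerFamily_zero p z)
  have hFd : Differentiable ℂ F := by
    rw [hF]
    have := differentiable_powerFamily p
    fun_prop
  have hFb : BddAbove ((norm ∘ F) '' Complex.HadamardThreeLines.verticalClosedStrip 0 1) := by
    refine ⟨∑ a ∈ s.range.filter (· ≠ 0), ∑ b ∈ t.range.filter (· ≠ 0),
      (1 + ‖a‖) ^ p * (1 + ‖b‖) ^ p *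
        ‖kernelPairing μ Λ ((s ⁻¹' {a}).indicator 1) ((t ⁻¹' {b}).indicator 1)‖, ?_⟩
    rintro _ ⟨z, hz, rfl⟩
    obtain ⟨h0, h1⟩ : 0 ≤ z.re ∧ z.re ≤ 1 := hz
    simp only [Function.comp, hF]
    refine norm_sum_le_of_le _ fun a _ => norm_sum_le_of_le _ fun b _ => ?_
    rw [norm_mul, norm_mul]
    gcongr
    · exact norm_powerFamily_le hp.le h0 h1
    · exact norm_powerFamily_le hp.le h0 h1
  -- On Re z = 0 both functions have modulus |·|^p, so the L¹ × L¹ bound is exactly `E`.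
  have hF0 : ∀ z ∈ Complex.re ⁻¹' {0}, ‖F z‖ ≤ E.toReal := by
    intro z hz
    have hz : z.re = 0 := hz
    rw [← toReal_enorm]
    refine ENNReal.toReal_mono hEfin ?_
    refine (enorm_kernelPairing_le hΛ1 (hmap t ht z).aestronglyMeasurable).trans (le_of_eq ?_)
    simp only [eLpNorm_one_eq_lintegral_enorm, enorm_powerFamily_of_re_zero hp hz, hE]
  -- On Re z = 1 the squared moduli are |·|^p, so Cauchy–Schwarz and the L²-bound give the square
  -- root of `E`.
  have hF1 : ∀ z ∈ Complex.re ⁻¹' {1}, ‖F z‖ ≤ E.toReal ^ (1 / 2 : ℝ) := by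
    intro z hz
    have hz : z.re = 1 := hz
    rw [← toReal_enorm, ENNReal.toReal_rpow]
    refine ENNReal.toReal_mono (ENNReal.rpow_ne_top_of_nonneg (by norm_num) hEfin) ?_
    refine (enorm_kernelPairing_le_of_sq hΛ hL2 (hmap s hs z) (hmap t ht z)).trans (le_of_eq ?_)
    simp only [enorm_powerFamily_sq_of_re_one hp hz, hE]
    rw [ENNReal.mul_rpow_of_nonneg _ _ (by norm_num)]
  have hθ0 : 0 ≤ 2 - 2 / p := by
    rw [sub_nonneg, div_le_iff₀ hp]
    linarith
  have hθ1 : 2 - 2 / p ≤ 1 := by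
    have : 1 ≤ 2 / p := by rw [le_div_iff₀ hp]; linarith
    linarith
  have key := Complex.HadamardThreeLines.norm_le_interp_of_mem_verticalClosedStrip₀₁' F
    (z := ((2 - 2 / p : ℝ) : ℂ)) (by
      change (((2 - 2 / p : ℝ) : ℂ)).re ∈ Set.Icc (0 : ℝ) 1
      rw [Complex.ofReal_re]
      exact ⟨hθ0, hθ1⟩) hFd.diffContOnCl hFb hF0 hF1
  -- With θ = 2 - 2/p the exponents add up to (1 - θ) + θ/2 = 1/p, and `E` to that power is the
  -- product of the two L^p-norms.
  rw [Complex.ofReal_re, ← Real.rpow_mul ENNReal.toReal_nonneg,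
    ← Real.rpow_add_of_nonneg ENNReal.toReal_nonneg (by linarith) (by linarith),
    show 1 - (2 - 2 / p) + 1 / 2 * (2 - 2 / p) = 1 / p by ring, ENNReal.toReal_rpow] at key
  simp only [F, powerFamily_eq_self hp] at key
  rw [← toReal_enorm, ENNReal.toReal_le_toReal (by finiteness)
    (ENNReal.rpow_ne_top_of_nonneg (by positivity) hEfin), hE,
    ENNReal.mul_rpow_of_nonneg _ _ (by positivity)] at key
  rw [eLpNorm_eq_lintegral_rpow_enorm_toReal hp0 ENNReal.ofReal_ne_top,
    eLpNorm_eq_lintegral_rpow_enorm_toReal hp0 ENNReal.ofReal_ne_top, ENNReal.toReal_ofReal hp.le]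
  exact key

/-- A functional that is continuous in `L¹` and bounded by the `L^p`-norm on simple functions is
bounded by the `L^p`-norm on `L¹ ∩ L^p`. -/
theorem enorm_le_mul_eLpNorm_of_simpleFunc {Φ : (X → ℂ) → ℂ} {p C D : ℝ≥0∞} (hp1 : 1 ≤ p)
    (hp : p ≠ ∞) (hC : C ≠ ∞) (hD : D ≠ ∞)
    (hΦ : ∀ u v : X → ℂ, Integrable u μ → Integrable v μ →
      ‖Φ u‖ₑ ≤ ‖Φ v‖ₑ + C * eLpNorm (v - u) 1 μ)
    (hs : ∀ s : SimpleFunc X ℂ, Integrable s μ → ‖Φ s‖ₑ ≤ D * eLpNorm s p μ)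
    {u : X → ℂ} (hu : Integrable u μ) (hup : MemLp u p μ) : ‖Φ u‖ₑ ≤ D * eLpNorm u p μ := by
  let f := hu.aestronglyMeasurable.mk u
  have hf : StronglyMeasurable f := hu.aestronglyMeasurable.stronglyMeasurable_mk
  have hfu : u =ᵐ[μ] f := hu.aestronglyMeasurable.ae_eq_mk
  have hf1 : MemLp f 1 μ := (memLp_congr_ae hfu).1 (memLp_one_iff_integrable.2 hu)
  have hfp : MemLp f p μ := (memLp_congr_ae hfu).1 hup
  -- A single sequence converges to `f` in L¹ and in L^p at once.
  let s : ℕ → SimpleFunc X ℂ := fun n =>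
    SimpleFunc.approxOn f hf.measurable (Set.range f ∪ {0}) 0 (by simp) n
  have h1 : Tendsto (fun n => eLpNorm (⇑(s n) - f) 1 μ) atTop (𝓝 0) :=
    SimpleFunc.tendsto_approxOn_range_Lp_eLpNorm ENNReal.one_ne_top hf.measurable hf1.2
  have h2 : Tendsto (fun n => eLpNorm (⇑(s n) - f) p μ) atTop (𝓝 0) :=
    SimpleFunc.tendsto_approxOn_range_Lp_eLpNorm hp hf.measurable hfp.2
  have hlim : Tendsto (fun n => D * (eLpNorm (⇑(s n) - f) p μ + eLpNorm f p μ) +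
      C * eLpNorm (⇑(s n) - f) 1 μ) atTop (𝓝 (D * (0 + eLpNorm f p μ) + C * 0)) :=
    (ENNReal.Tendsto.const_mul (h2.add tendsto_const_nhds) (Or.inr hD)).add
      (ENNReal.Tendsto.const_mul h1 (Or.inr hC))
  rw [zero_add, mul_zero, add_zero] at hlim
  rw [eLpNorm_congr_ae hfu]
  refine ge_of_tendsto' hlim fun n => ?_
  have hsn : Integrable (s n) μ := memLp_one_iff_integrable.1
    (SimpleFunc.memLp_approxOn_range hf.measurable hf1 n)
  have hcongr : eLpNorm (⇑(s n) - u) 1 μ = eLpNorm (⇑(s n) - f) 1 μ :=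
    eLpNorm_congr_ae (EventuallyEq.rfl.sub hfu)
  have h3 := (hΦ u (s n) hu hsn).trans (add_le_add (hs (s n) hsn) le_rfl)
  rw [hcongr] at h3
  refine h3.trans (add_le_add ?_ le_rfl)
  gcongr
  have := eLpNorm_add_le (((s n).aestronglyMeasurable (μ := μ)).sub hf.aestronglyMeasurable)
    hf.aestronglyMeasurable hp1
  rwa [sub_add_cancel] at this

theorem kernelPairing_sub_left [SFinite μ] (hΛ : StronglyMeasurable (Function.uncurry Λ))
    (hΛ1 : ∀ x l, ‖Λ x l‖ ≤ 1) {u v w : X → ℂ} (hu : Integrable u μ) (hv : Integrable v μ)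
    (hw : Integrable w μ) :
    kernelPairing μ Λ (u - v) w = kernelPairing μ Λ u w - kernelPairing μ Λ v w := by
  simp only [kernelPairing, kernelIntegral_sub hΛ hΛ1 hu hv, Pi.sub_apply, sub_mul]
  exact integral_sub (integrable_kernelIntegral_mul hΛ hΛ1 hu hw)
    (integrable_kernelIntegral_mul hΛ hΛ1 hv hw)

theorem kernelPairing_sub_right [SFinite μ] (hΛ : StronglyMeasurable (Function.uncurry Λ))
    (hΛ1 : ∀ x l, ‖Λ x l‖ ≤ 1) {u v w : X → ℂ} (hu : Integrable u μ) (hv : Integrable v μ)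
    (hw : Integrable w μ) :
    kernelPairing μ Λ w (u - v) = kernelPairing μ Λ w u - kernelPairing μ Λ w v := by
  simp only [kernelPairing, Pi.sub_apply, mul_sub]
  exact integral_sub (integrable_kernelIntegral_mul hΛ hΛ1 hw hu)
    (integrable_kernelIntegral_mul hΛ hΛ1 hw hv)

/-- Density in one variable at a time: the second argument is freed while the first is simple, and
then the first is freed. -/
theorem enorm_kernelPairing_le_eLpNorm_mul [SFinite μ]
    (hΛ : StronglyMeasurable (Function.uncurry Λ)) (hΛ1 : ∀ x l, ‖Λ x l‖ ≤ 1)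
    (hL2 : ∀ u : X → ℂ, Integrable u μ →
      ∫⁻ l, ‖kernelIntegral μ Λ u l‖ₑ ^ 2 ∂μ ≤ ∫⁻ x, ‖u x‖ₑ ^ 2 ∂μ)
    {p : ℝ} (hp1 : 1 ≤ p) (hp2 : p ≤ 2) {u v : X → ℂ} (hu : Integrable u μ)
    (hup : MemLp u (ENNReal.ofReal p) μ) (hv : Integrable v μ)
    (hvp : MemLp v (ENNReal.ofReal p) μ) :
    ‖kernelPairing μ Λ u v‖ₑ ≤
      eLpNorm u (ENNReal.ofReal p) μ * eLpNorm v (ENNReal.ofReal p) μ := by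
  have hp0 : ENNReal.ofReal p ≠ 0 := by
    simp only [ne_eq, ENNReal.ofReal_eq_zero, not_le]
    linarith
  have hp1' : 1 ≤ ENNReal.ofReal p := by simpa using hp1
  have htri : ∀ a b : ℂ, ‖b‖ₑ ≤ ‖a‖ₑ + ‖a - b‖ₑ := fun a b => by
    have := enorm_sub_le (a := a) (b := a - b)
    rwa [sub_sub_cancel] at this
  have step : ∀ s : SimpleFunc X ℂ, Integrable s μ → ‖kernelPairing μ Λ s v‖ₑ ≤
      eLpNorm s (ENNReal.ofReal p) μ * eLpNorm v (ENNReal.ofReal p) μ := by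
    intro s hs
    have hs1 := memLp_one_iff_integrable.2 hs
    have hsp : MemLp s (ENNReal.ofReal p) μ :=
      (SimpleFunc.memLp_iff_integrable hp0 ENNReal.ofReal_ne_top).2 hs
    refine enorm_le_mul_eLpNorm_of_simpleFunc (Φ := fun w => kernelPairing μ Λ s w)
      (C := eLpNorm s 1 μ) hp1' ENNReal.ofReal_ne_top hs1.eLpNorm_ne_top hsp.eLpNorm_ne_top
      (fun w w' hw hw' => ?_)
      (fun t ht => enorm_kernelPairing_simpleFunc_le hΛ hΛ1 hL2 hp1 hp2 hs ht) hv hvp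
    refine (htri _ _).trans (add_le_add le_rfl ?_)
    rw [← kernelPairing_sub_right hΛ hΛ1 hw' hw hs]
    exact enorm_kernelPairing_le hΛ1 (hw'.sub hw).aestronglyMeasurable
  rw [mul_comm]
  refine enorm_le_mul_eLpNorm_of_simpleFunc (Φ := fun w => kernelPairing μ Λ w v)
    (C := eLpNorm v 1 μ) hp1' ENNReal.ofReal_ne_top
    (memLp_one_iff_integrable.2 hv).eLpNorm_ne_top hvp.eLpNorm_ne_top
    (fun w w' hw hw' => ?_) (fun s hs => by rw [mul_comm]; exact step s hs) hu hup
  refine (htri _ _).trans (add_le_add le_rfl ?_)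
  rw [← kernelPairing_sub_left hΛ hΛ1 hw' hw hv, mul_comm]
  exact enorm_kernelPairing_le hΛ1 hv.aestronglyMeasurable

/-- The Hausdorff–Young inequality for an integral operator with bounded kernel that contracts
the `L²`-norm. -/
theorem eLpNorm_kernelIntegral_le [SigmaFinite μ]
    (hΛ : StronglyMeasurable (Function.uncurry Λ)) (hΛ1 : ∀ x l, ‖Λ x l‖ ≤ 1)
    (hL2 : ∀ u : X → ℂ, Integrable u μ →
      ∫⁻ l, ‖kernelIntegral μ Λ u l‖ₑ ^ 2 ∂μ ≤ ∫⁻ x, ‖u x‖ₑ ^ 2 ∂μ)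
    {p q : ℝ} (hpq : p.HolderConjugate q) (hp2 : p ≤ 2) {u : X → ℂ} (hu : Integrable u μ)
    (hup : MemLp u (ENNReal.ofReal p) μ) :
    eLpNorm (kernelIntegral μ Λ u) (ENNReal.ofReal q) μ ≤ eLpNorm u (ENNReal.ofReal p) μ := by
  have hp := hpq.pos
  have hq := hpq.symm.pos
  have hp0 : ENNReal.ofReal p ≠ 0 := by simpa using hp
  have hq0 : ENNReal.ofReal q ≠ 0 := by simpa using hq
  have hconj : (q - 1) * p = q := hpq.symm.sub_one_mul_conj
  have hq2 : 2 ≤ q := by nlinarith [hpq.symm.lt]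
  set g := kernelIntegral μ Λ u with hg
  have hgm : StronglyMeasurable g := stronglyMeasurable_kernelIntegral hΛ hu.aestronglyMeasurable
  have hgb := norm_kernelIntegral_le (Λ := Λ) hΛ1 hu
  rw [← hg] at hgb
  set C := (eLpNorm u 1 μ).toReal with hC
  have hC0 : 0 ≤ C := ENNReal.toReal_nonneg
  set M := eLpNorm u (ENNReal.ofReal p) μ with hM
  have hfinite : ∀ S, MeasurableSet S → μ S < ∞ → (∫⁻ l in S, ‖g l‖ₑ ^ q ∂μ) ≤ M ^ q := by
    intro S hS hμS
    -- The extremal function for L^p–L^q duality: on S, g v = |g|^q = |v|^p. Since g is bounded and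
    -- μ(S) is finite, v lies in every L^r.
    let v : X → ℂ := S.indicator fun l => (starRingEnd ℂ) (g l) * ((‖g l‖ ^ (q - 2) : ℝ) : ℂ)
    have hvm : StronglyMeasurable v := by
      refine StronglyMeasurable.indicator ?_ hS
      have h1 : StronglyMeasurable fun l => (starRingEnd ℂ) (g l) :=
        Complex.continuous_conj.comp_stronglyMeasurable hgm
      have h2 : Measurable fun l => ((‖g l‖ ^ (q - 2) : ℝ) : ℂ) :=
        Complex.measurable_ofReal.comp (hgm.norm.measurable.pow_const _)
      exact h1.mul h2.stronglyMeasurable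
    have hvnorm : ∀ l ∈ S, ‖v l‖ = ‖g l‖ ^ (q - 1) := by
      intro l hl
      simp only [v, Set.indicator_of_mem hl]
      rw [norm_mul, RCLike.norm_conj, Complex.norm_real, Real.norm_of_nonneg (by positivity),
        show q - 1 = 1 + (q - 2) by ring,
        Real.rpow_add_of_nonneg (norm_nonneg _) zero_le_one (by linarith), Real.rpow_one]
    have hvbdd : ∀ l, ‖v l‖ ≤ S.indicator (fun _ => C ^ (q - 1)) l := by
      intro l
      by_cases hl : l ∈ S
      · rw [hvnorm l hl, Set.indicator_of_mem hl]
        exact Real.rpow_le_rpow (norm_nonneg _) (hgb l) (by linarith)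
      · simp [v, hl]
    have hvlp : ∀ r : ℝ≥0∞, MemLp v r μ := fun r =>
      (memLp_indicator_const r hS (C ^ (q - 1)) (Or.inr hμS.ne)).mono hvm.aestronglyMeasurable
        (Eventually.of_forall fun l => (hvbdd l).trans (le_abs_self _))
    have hgv : ∀ l, g l * v l = ((S.indicator (fun l => ‖g l‖ ^ q) l : ℝ) : ℂ) := by
      intro l
      by_cases hl : l ∈ S
      · simp only [v, Set.indicator_of_mem hl]
        rw [← mul_assoc, Complex.mul_conj', ← Complex.ofReal_pow, ← Complex.ofReal_mul,
          ← Real.rpow_natCast, ← Real.rpow_add_of_nonneg (norm_nonneg _) (by norm_num)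
          (by linarith)]
        congr 2
        push_cast
        ring
      · simp [v, hl]
    have hv1 := memLp_one_iff_integrable.1 (hvlp 1)
    set J := ∫⁻ l in S, ‖g l‖ₑ ^ q ∂μ with hJ
    have hind : ∀ l, ENNReal.ofReal (S.indicator (fun l => ‖g l‖ ^ q) l) =
        S.indicator (fun l => ‖g l‖ₑ ^ q) l := by
      intro l
      by_cases hl : l ∈ S
      · rw [Set.indicator_of_mem hl, Set.indicator_of_mem hl, ← ofReal_norm,
          ENNReal.ofReal_rpow_of_nonneg (norm_nonneg _) hq.le]
      · simp [hl]
    have hpos : ∀ l, 0 ≤ S.indicator (fun l => ‖g l‖ ^ q) l := fun l =>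
      Set.indicator_nonneg (fun l _ => by positivity) l
    have hpair : ‖kernelPairing μ Λ u v‖ₑ = J := by
      have hint := integrable_kernelIntegral_mul hΛ hΛ1 hu hv1
      rw [← hg] at hint
      simp only [hgv] at hint
      have hint' : Integrable (S.indicator fun l => ‖g l‖ ^ q) μ := by
        simpa using hint.re
      rw [kernelPairing, ← hg]
      simp only [hgv]
      rw [integral_complex_ofReal, ← ofReal_norm, Complex.norm_real,
        Real.norm_of_nonneg (integral_nonneg hpos),
        ofReal_integral_eq_lintegral_ofReal hint' (Eventually.of_forall hpos)]
      simp only [hind]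
      rw [lintegral_indicator hS]
    have hvp : eLpNorm v (ENNReal.ofReal p) μ = J ^ (1 / p) := by
      rw [eLpNorm_eq_lintegral_rpow_enorm_toReal hp0 ENNReal.ofReal_ne_top,
        ENNReal.toReal_ofReal hp.le, hJ, ← lintegral_indicator hS]
      congr 2
      ext l
      by_cases hl : l ∈ S
      · rw [Set.indicator_of_mem hl, ← ofReal_norm, hvnorm l hl, ← ofReal_norm,
          ENNReal.ofReal_rpow_of_nonneg (by positivity) hp.le,
          ENNReal.ofReal_rpow_of_nonneg (by positivity) hq.le, ← Real.rpow_mul (norm_nonneg _),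
          hconj]
      · simp [v, hl, hp]
    have hmain := enorm_kernelPairing_le_eLpNorm_mul hΛ hΛ1 hL2 hpq.lt.le hp2 hu hup hv1
      (hvlp (ENNReal.ofReal p))
    rw [hpair, hvp, ← hM] at hmain
    -- The pairing bound reads J ≤ M J^{1/p}; finiteness of J permits division by J^{1/p}.
    have hJtop : J ≠ ∞ := by rw [← hpair]; finiteness
    rcases eq_or_ne J 0 with h0 | h0
    · rw [h0]
      exact zero_le
    · have h1 : J ^ (1 / q) * J ^ (1 / p) = J := by
        rw [← ENNReal.rpow_add _ _ h0 hJtop, one_div, one_div, add_comm, hpq.inv_add_inv_eq_one,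
          ENNReal.rpow_one]
      have h2 : J ^ (1 / q) ≤ M := by
        have h3 : J ^ (1 / p) ≠ 0 := by simp [h0, hJtop]
        have h4 : J ^ (1 / p) ≠ ∞ := ENNReal.rpow_ne_top_of_nonneg (by positivity) hJtop
        rw [← ENNReal.mul_le_mul_iff_left h3 h4, h1]
        exact hmain
      calc J = (J ^ (1 / q)) ^ q := by
            rw [← ENNReal.rpow_mul, one_div, inv_mul_cancel₀ hq.ne', ENNReal.rpow_one]
        _ ≤ M ^ q := by gcongr
  have hall : ∫⁻ l, ‖g l‖ₑ ^ q ∂μ ≤ M ^ q := by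
    rw [← setLIntegral_univ, ← iUnion_spanningSets μ, setLIntegral_iUnion_of_directed _
      (monotone_spanningSets μ).directed_le]
    exact iSup_le fun n =>
      hfinite _ (measurableSet_spanningSets μ n) (measure_spanningSets_lt_top μ n)
  rw [eLpNorm_eq_lintegral_rpow_enorm_toReal hq0 ENNReal.ofReal_ne_top, ENNReal.toReal_ofReal hq.le]
  calc _ ≤ (M ^ q) ^ (1 / q) := by gcongr
    _ = M := by rw [← ENNReal.rpow_mul, mul_one_div_cancel hq.ne', ENNReal.rpow_one]

end Interpolation

/-! ### Size of the normalizing constant -/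

theorem weinsteinConst_pos (d : ℕ) {α : ℝ} (hα : -1 / 2 ≤ α) : 0 < weinsteinConst d α := by
  have hG : 0 < Real.Gamma (α + 1) := Real.Gamma_pos_of_pos (by linarith)
  unfold weinsteinConst
  positivity

/-- The three factors of the denominator are at least 5/2, 7/10 and 3/4, whose product exceeds 1; d
≥ 1 is needed for the first. -/
theorem weinsteinConst_le_one {d : ℕ} (hd : 1 ≤ d) {α : ℝ} (hα : -1 / 2 ≤ α) :
    weinsteinConst d α ≤ 1 := by
  have hG : 3 / 4 ≤ Real.Gamma (α + 1) := Real.three_quarters_le_Gamma (by linarith)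
  have hd' : (1 : ℝ) ≤ d := by exact_mod_cast hd
  have hpi := Real.pi_gt_d2
  have h1 : (5 / 2 : ℝ) ≤ (2 * Real.pi) ^ ((d : ℝ) / 2) := by
    calc (5 / 2 : ℝ) ≤ √(2 * Real.pi) := Real.le_sqrt_of_sq_le (by nlinarith)
      _ = (2 * Real.pi) ^ (1 / 2 : ℝ) := Real.sqrt_eq_rpow _
      _ ≤ _ := Real.rpow_le_rpow_of_exponent_le (by linarith) (by linarith)
  have h2 : (7 / 10 : ℝ) ≤ (2 : ℝ) ^ α := by
    calc (7 / 10 : ℝ) ≤ √(1 / 2) := Real.le_sqrt_of_sq_le (by norm_num)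
      _ = (1 / 2 : ℝ) ^ (1 / 2 : ℝ) := Real.sqrt_eq_rpow _
      _ = (2 : ℝ) ^ (-(1 / 2) : ℝ) := by
        rw [Real.rpow_neg (by norm_num), one_div, Real.inv_rpow (by norm_num)]
      _ ≤ _ := Real.rpow_le_rpow_of_exponent_le (by norm_num) (by linarith)
  have h3 : (5 / 2 : ℝ) * (7 / 10) ≤ (2 * Real.pi) ^ ((d : ℝ) / 2) * (2 : ℝ) ^ α :=
    mul_le_mul h1 h2 (by norm_num) (by linarith)
  have h4 : (5 / 2 : ℝ) * (7 / 10) * (3 / 4) ≤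
      (2 * Real.pi) ^ ((d : ℝ) / 2) * (2 : ℝ) ^ α * Real.Gamma (α + 1) :=
    mul_le_mul h3 hG (by norm_num) (by linarith)
  rw [weinsteinConst, div_le_one (by linarith)]
  linarith

theorem MeasureTheory.eLpNorm_sub_le_eLpNorm_sub_add {X : Type*} [MeasurableSpace X]
    {μ : Measure X} {p : ℝ≥0∞} (hp : 1 ≤ p) {f g h : X → ℂ} (hf : AEStronglyMeasurable f μ)
    (hg : AEStronglyMeasurable g μ) (hh : AEStronglyMeasurable h μ) :
    eLpNorm (f - h) p μ ≤ eLpNorm (f - g) p μ + eLpNorm (g - h) p μ := by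
  have := eLpNorm_add_le (hf.sub hg) (hg.sub hh) hp
  rwa [sub_add_sub_cancel] at this

/-! ### The Weinstein transform on L^p -/

section Transform

variable {d : ℕ} {α κ p q : ℝ}

local notation "μW" => weinsteinMeasure d α κ
local notation "pW" => ENNReal.ofReal p
local notation "qW" => ENNReal.ofReal q

/-- The Hausdorff–Young inequality for the Weinstein transform on `L¹ ∩ L^p`. -/
theorem eLpNorm_weinsteinIntegral_le (hα : -1 / 2 ≤ α) (hκ : 0 ≤ κ) (hκ1 : κ ≤ weinsteinConst d α)
    (hpq : p.HolderConjugate q) (hp2 : p ≤ 2) {u : WSpace d → ℂ} (hu : Integrable u μW)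
    (hup : MemLp u pW μW) :
    eLpNorm (weinsteinIntegral d α κ u) qW μW ≤ eLpNorm u pW μW :=
  eLpNorm_kernelIntegral_le (continuous_weinsteinKernel d hα).stronglyMeasurable
    (norm_weinsteinKernel_le_one d hα)
    (fun _ hw => lintegral_enorm_weinsteinIntegral_sq_le hα hκ hκ1 hw) hpq hp2 hu hup

theorem weinsteinIntegral_sub (hα : -1 / 2 ≤ α) {u v : WSpace d → ℂ} (hu : Integrable u μW)
    (hv : Integrable v μW) : weinsteinIntegral d α κ (u - v) =
      weinsteinIntegral d α κ u - weinsteinIntegral d α κ v :=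
  kernelIntegral_sub (continuous_weinsteinKernel d hα).stronglyMeasurable
    (norm_weinsteinKernel_le_one d hα) hu hv

theorem eLpNorm_weinsteinIntegral_sub_le (hα : -1 / 2 ≤ α) (hκ : 0 ≤ κ)
    (hκ1 : κ ≤ weinsteinConst d α) (hpq : p.HolderConjugate q) (hp2 : p ≤ 2)
    {u v : WSpace d → ℂ} (hu : MemLp u 1 μW) (hup : MemLp u pW μW) (hv : MemLp v 1 μW)
    (hvp : MemLp v pW μW) :
    eLpNorm (weinsteinIntegral d α κ u - weinsteinIntegral d α κ v) qW μW ≤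
      eLpNorm (u - v) pW μW := by
  rw [memLp_one_iff_integrable] at hu hv
  rw [← weinsteinIntegral_sub hα hu hv]
  exact eLpNorm_weinsteinIntegral_le hα hκ hκ1 hpq hp2 (hu.sub hv) (hup.sub hvp)

theorem memLp_weinsteinIntegral (hα : -1 / 2 ≤ α) (hκ : 0 ≤ κ) (hκ1 : κ ≤ weinsteinConst d α)
    (hpq : p.HolderConjugate q) (hp2 : p ≤ 2) {u : WSpace d → ℂ} (hu : MemLp u 1 μW)
    (hup : MemLp u pW μW) : MemLp (weinsteinIntegral d α κ u) qW μW :=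
  ⟨(continuous_weinsteinIntegral hα (memLp_one_iff_integrable.1 hu)).aestronglyMeasurable,
    (eLpNorm_weinsteinIntegral_le hα hκ hκ1 hpq hp2 (memLp_one_iff_integrable.1 hu) hup).trans_lt
      hup.2⟩

theorem isWeinsteinTransform_weinsteinIntegral (hα : -1 / 2 ≤ α) (hκ : 0 ≤ κ)
    (hκ1 : κ ≤ weinsteinConst d α) (hpq : p.HolderConjugate q) (hp2 : p ≤ 2)
    {u : WSpace d → ℂ} (hu : MemLp u 1 μW) (hup : MemLp u pW μW) :
    IsWeinsteinTransform d α κ pW qW u (weinsteinIntegral d α κ u) :=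
  ⟨memLp_weinsteinIntegral hα hκ hκ1 hpq hp2 hu hup, fun _ => u, fun _ => ⟨hu, hup⟩,
    by simp, by simp⟩

/-- Hausdorff–Young for differences of approximants passes to the limit. The case φ = ψ shows that
the transform does not depend on the approximating sequence. -/
theorem IsWeinsteinTransform.eLpNorm_sub_le (hα : -1 / 2 ≤ α) (hκ : 0 ≤ κ)
    (hκ1 : κ ≤ weinsteinConst d α) (hpq : p.HolderConjugate q) (hp2 : p ≤ 2)
    {φ ψ f g : WSpace d → ℂ} (hf : IsWeinsteinTransform d α κ pW qW φ f)
    (hg : IsWeinsteinTransform d α κ pW qW ψ g) (hφ : AEStronglyMeasurable φ μW)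
    (hψ : AEStronglyMeasurable ψ μW) :
    eLpNorm (f - g) qW μW ≤ eLpNorm (φ - ψ) pW μW := by
  obtain ⟨hfm, u, hu, huφ, huf⟩ := hf
  obtain ⟨hgm, v, hv, hvψ, hvg⟩ := hg
  have hp1 : 1 ≤ pW := by simpa using hpq.lt.le
  have hq1 : 1 ≤ qW := by simpa using hpq.symm.lt.le
  have hlim := (((huφ.add (tendsto_const_nhds (x := eLpNorm (φ - ψ) pW μW))).add hvψ).add
    huf).add hvg
  simp only [zero_add, add_zero] at hlim
  refine ge_of_tendsto' hlim fun n => ?_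
  have hWu := (memLp_weinsteinIntegral hα hκ hκ1 hpq hp2 (hu n).1 (hu n).2).1
  have hWv := (memLp_weinsteinIntegral hα hκ hκ1 hpq hp2 (hv n).1 (hv n).2).1
  have h1 := eLpNorm_sub_le_eLpNorm_sub_add hq1 hfm.1 hWu hgm.1
  have h2 := eLpNorm_sub_le_eLpNorm_sub_add hq1 hWu hWv hgm.1
  have h3 := eLpNorm_weinsteinIntegral_sub_le hα hκ hκ1 hpq hp2 (hu n).1 (hu n).2 (hv n).1
    (hv n).2
  have h4 := eLpNorm_sub_le_eLpNorm_sub_add hp1 (hu n).2.1 hφ (hv n).2.1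
  have h5 := eLpNorm_sub_le_eLpNorm_sub_add hp1 hφ hψ (hv n).2.1
  rw [eLpNorm_sub_comm f (weinsteinIntegral d α κ (u n))] at h1
  rw [eLpNorm_sub_comm ψ (v n)] at h5
  calc eLpNorm (f - g) qW μW ≤ eLpNorm (weinsteinIntegral d α κ (u n) - f) qW μW +
        ((eLpNorm (u n - φ) pW μW + (eLpNorm (φ - ψ) pW μW + eLpNorm (v n - ψ) pW μW)) +
          eLpNorm (weinsteinIntegral d α κ (v n) - g) qW μW) := by
        refine h1.trans (add_le_add le_rfl (h2.trans (add_le_add (h3.trans (h4.trans ?_)) le_rfl)))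
        exact add_le_add le_rfl h5
    _ = _ := by ring

/-- Simple functions in L^p are integrable and dense; by Hausdorff–Young their transforms are Cauchy
in L^q, which is complete. -/
theorem exists_isWeinsteinTransform (hα : -1 / 2 ≤ α) (hκ : 0 ≤ κ)
    (hκ1 : κ ≤ weinsteinConst d α) (hpq : p.HolderConjugate q) (hp2 : p ≤ 2)
    {φ : WSpace d → ℂ} (hφ : MemLp φ pW μW) :
    ∃ g, IsWeinsteinTransform d α κ pW qW φ g := by
  have hp0 : pW ≠ 0 := by simpa using hpq.pos
  have : Fact (1 ≤ pW) := ⟨by simpa using hpq.lt.le⟩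
  have : Fact (1 ≤ qW) := ⟨by simpa using hpq.symm.lt.le⟩
  have hs : ∀ n : ℕ, ∃ s : SimpleFunc (WSpace d) ℂ,
      eLpNorm (φ - ⇑s) pW μW < ((n : ℝ≥0∞) + 1)⁻¹ ∧ MemLp s pW μW := fun n =>
    hφ.exists_simpleFunc_eLpNorm_sub_lt ENNReal.ofReal_ne_top (by simp)
  choose s hs hsp using hs
  have hs1 : ∀ n, MemLp (s n) 1 μW := fun n => memLp_one_iff_integrable.2
    ((SimpleFunc.memLp_iff_integrable hp0 ENNReal.ofReal_ne_top).1 (hsp n))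
  have hlim : Tendsto (fun n => eLpNorm (⇑(s n) - φ) pW μW) atTop (𝓝 0) := by
    have h0 : Tendsto (fun n : ℕ => ((n : ℝ≥0∞) + 1)⁻¹) atTop (𝓝 0) := by
      have := (tendsto_add_atTop_iff_nat 1).2 ENNReal.tendsto_inv_nat_nhds_zero
      simpa using this
    refine tendsto_of_tendsto_of_tendsto_of_le_of_le tendsto_const_nhds h0 (fun _ => zero_le)
      fun n => ?_
    rw [eLpNorm_sub_comm]
    exact (hs n).le
  have hW : ∀ n, MemLp (weinsteinIntegral d α κ (s n)) qW μW := fun n =>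
    memLp_weinsteinIntegral hα hκ hκ1 hpq hp2 (hs1 n) (hsp n)
  have hcauchy : CauchySeq fun n => (hsp n).toLp (s n) :=
    ((Lp.tendsto_Lp_iff_tendsto_eLpNorm'' (fun n => ⇑(s n)) hsp φ hφ).2 hlim).cauchySeq
  have hcauchyW : CauchySeq fun n => (hW n).toLp (weinsteinIntegral d α κ (s n)) := by
    rw [EMetric.cauchySeq_iff] at hcauchy ⊢
    intro ε hε
    obtain ⟨N, hN⟩ := hcauchy ε hε
    refine ⟨N, fun m hm n hn => lt_of_le_of_lt ?_ (hN m hm n hn)⟩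
    rw [Lp.edist_toLp_toLp, Lp.edist_toLp_toLp]
    exact eLpNorm_weinsteinIntegral_sub_le hα hκ hκ1 hpq hp2 (hs1 m) (hsp m) (hs1 n) (hsp n)
  obtain ⟨G, hG⟩ := cauchySeq_tendsto_of_complete hcauchyW
  refine ⟨G, Lp.memLp G, fun n => s n, fun n => ⟨hs1 n, hsp n⟩, hlim, ?_⟩
  rw [← Lp.tendsto_Lp_iff_tendsto_eLpNorm'' _ hW _ (Lp.memLp G), Lp.toLp_coeFn]
  exact hG

theorem isWeinsteinTransform_weinsteinTransform (hα : -1 / 2 ≤ α) (hκ : 0 ≤ κ)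
    (hκ1 : κ ≤ weinsteinConst d α) (hpq : p.HolderConjugate q) (hp2 : p ≤ 2)
    {φ : WSpace d → ℂ} (hφ : MemLp φ pW μW) :
    IsWeinsteinTransform d α κ pW qW φ (weinsteinTransform d α κ pW qW φ) := by
  have h := exists_isWeinsteinTransform hα hκ hκ1 hpq hp2 hφ
  rw [weinsteinTransform, dif_pos h]
  exact h.choose_spec

/-! ### Concentration estimates and the theorem -/

/-- Hölder's inequality for the restriction to a set. -/
theorem eLpNorm_one_indicator_le (hpq : p.HolderConjugate q) {Ω : Set (WSpace d)}
    (hΩ : MeasurableSet Ω) {φ : WSpace d → ℂ} (hφ : MemLp φ pW μW) :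
    eLpNorm (Ω.indicator φ) 1 μW ≤ μW Ω ^ (1 / q) * eLpNorm φ pW μW := by
  have hp1 : 1 ≤ pW := by simpa using hpq.lt.le
  have h := eLpNorm_le_eLpNorm_mul_rpow_measure_univ (μ := (weinsteinMeasure d α κ).restrict Ω) hp1
    hφ.1.restrict
  have he : 1 / (1 : ℝ≥0∞).toReal - 1 / (pW).toReal = 1 / q := by
    rw [ENNReal.toReal_ofReal hpq.pos.le, ENNReal.toReal_one]
    have := hpq.inv_add_inv_eq_one
    simp only [one_div, inv_one]
    linarith
  rw [he, Measure.restrict_apply_univ] at h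
  rw [eLpNorm_indicator_eq_eLpNorm_restrict hΩ, mul_comm]
  refine h.trans ?_
  gcongr
  exact Measure.restrict_le_self

theorem eLpNorm_indicator_weinsteinIntegral_le (hα : -1 / 2 ≤ α) (hq : 0 ≤ q)
    {S : Set (WSpace d)} (hS : MeasurableSet S) (u : WSpace d → ℂ) :
    eLpNorm (S.indicator (weinsteinIntegral d α κ u)) qW μW ≤
      μW S ^ (1 / q) * eLpNorm u 1 μW := by
  rw [eLpNorm_indicator_eq_eLpNorm_restrict hS]
  refine (eLpNorm_le_of_ae_enorm_bound (C := eLpNorm u 1 μW) (Eventually.of_forall fun l =>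
    enorm_kernelIntegral_le (norm_weinsteinKernel_le_one d hα) u l)).trans ?_
  rw [Measure.restrict_apply_univ, ENNReal.toReal_ofReal hq, smul_eq_mul, mul_comm, one_div]

theorem eLpNorm_indicator_le_of_isWeinsteinTransform (hα : -1 / 2 ≤ α) (hκ : 0 ≤ κ)
    (hκ1 : κ ≤ weinsteinConst d α) (hpq : p.HolderConjugate q) (hp2 : p ≤ 2)
    {Ω S : Set (WSpace d)} (hΩ : MeasurableSet Ω) (hS : MeasurableSet S) {φ g : WSpace d → ℂ}
    (hφ : MemLp φ pW μW) {ε : ℝ≥0} (hφΩ : IsConcentrated μW pW ε Ω φ)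
    (hg : IsWeinsteinTransform d α κ pW qW φ g) :
    eLpNorm (S.indicator g) qW μW ≤
      (μW S ^ (1 / q) * μW Ω ^ (1 / q) + ε) * eLpNorm φ pW μW := by
  have hq := hpq.symm.pos
  have hq1 : 1 ≤ qW := by simpa using hpq.symm.lt.le
  -- The degenerate cases are separated because of 0 · ∞ = 0. If μ(Ω) = ∞, then χ_Ω φ need not be
  -- integrable, but the bound is infinite unless μ(S) = 0 or φ = 0 almost everywhere, and then the
  -- left side vanishes.
  by_cases hS0 : μW S = 0
  · rw [eLpNorm_congr_ae (indicator_meas_zero hS0), eLpNorm_zero]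
    exact zero_le
  by_cases hΩt : μW Ω = ∞
  · by_cases h0 : eLpNorm φ pW μW = 0
    · have hzero := isWeinsteinTransform_weinsteinIntegral (d := d) (u := 0) hα hκ hκ1 hpq hp2
        MemLp.zero MemLp.zero
      have hW0 : weinsteinIntegral d α κ (0 : WSpace d → ℂ) = 0 := by
        ext l
        simp [weinsteinIntegral]
      rw [hW0] at hzero
      have h1 := hg.eLpNorm_sub_le hα hκ hκ1 hpq hp2 hzero hφ.1 aestronglyMeasurable_zero
      rw [sub_zero, sub_zero, h0] at h1
      exact ((eLpNorm_indicator_le g).trans h1).trans zero_le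
    · have : μW S ^ (1 / q) ≠ 0 := by simp [hS0, hq.le]
      rw [hΩt, ENNReal.top_rpow_of_pos (by positivity), ENNReal.mul_top this, top_add,
        ENNReal.top_mul h0]
      exact le_top
  · have hL1 := eLpNorm_one_indicator_le hpq hΩ hφ
    have hf1 : MemLp (Ω.indicator φ) 1 μW := ⟨hφ.1.indicator hΩ, hL1.trans_lt
      (ENNReal.mul_lt_top (ENNReal.rpow_lt_top_of_nonneg (by positivity) hΩt) hφ.2)⟩
    have hfp : MemLp (Ω.indicator φ) pW μW := hφ.indicator hΩ
    have hT := isWeinsteinTransform_weinsteinIntegral hα hκ hκ1 hpq hp2 hf1 hfp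
    set g₁ := weinsteinIntegral d α κ (Ω.indicator φ)
    have h1 : eLpNorm (S.indicator g₁) qW μW ≤
        μW S ^ (1 / q) * μW Ω ^ (1 / q) * eLpNorm φ pW μW := by
      refine (eLpNorm_indicator_weinsteinIntegral_le hα hq.le hS _).trans ?_
      rw [mul_assoc]
      gcongr
    have h2 : eLpNorm (S.indicator (g - g₁)) qW μW ≤ ε * eLpNorm φ pW μW :=
      ((eLpNorm_indicator_le _).trans
        -- The contraction applied to φ and χ_Ω φ turns the concentration of φ into a bound for the
        -- difference of their transforms.
        (hg.eLpNorm_sub_le hα hκ hκ1 hpq hp2 hT hφ.1 hfp.1)).trans hφΩ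
    have h3 := eLpNorm_add_le (hT.1.1.indicator hS) ((hg.1.1.sub hT.1.1).indicator hS) hq1
    rw [← Set.indicator_add', add_sub_cancel] at h3
    rw [add_mul]
    exact h3.trans (add_le_add h1 h2)

end Transform

/-- Absorption of ε N into the left side; N must be finite, since N = ∞ with ε > 0 satisfies the
hypothesis for every R. -/
theorem ENNReal.le_div_one_sub_of_le_mul_add {N R ε : ℝ≥0∞} (hN : N ≠ ∞) (hε : ε < 1)
    (h : N ≤ ε * N + R) : N ≤ R / (1 - ε) := by
  rw [ENNReal.le_div_iff_mul_le (Or.inl (tsub_pos_of_lt hε).ne') (Or.inl (by finiteness)),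
    ENNReal.mul_sub (fun _ _ => hN), mul_one, tsub_le_iff_left, mul_comm N]
  exact h

theorem theoremB (d : ℕ) (hd : 1 ≤ d) (α : ℝ) (hα : -1 / 2 < α)
    (κ : ℝ) (hκ : κ = weinsteinConst d α ∨ κ = weinsteinConst d α ^ 2)
    (p q : ℝ) (hp1 : 1 < p) (hp2 : p ≤ 2) (hq : q = p / (p - 1))
    (Ω Sig : Set (WSpace d)) (hΩ : MeasurableSet Ω) (hSig : MeasurableSet Sig)
    (hΩs : Ω ⊆ halfSpace d) (hSigs : Sig ⊆ halfSpace d)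
    (φ : WSpace d → ℂ) (hφ : MemLp φ (ENNReal.ofReal p) (weinsteinMeasure d α κ))
    (εΩ εSig : ℝ≥0) (hεSig : εSig < 1)
    (hφΩ : IsConcentrated (weinsteinMeasure d α κ) (ENNReal.ofReal p) εΩ Ω φ)
    (hφSig : IsConcentrated (weinsteinMeasure d α κ) (ENNReal.ofReal q) εSig Sig
      (weinsteinTransform d α κ (ENNReal.ofReal p) (ENNReal.ofReal q) φ)) :
    IsWeinsteinTransform d α κ (ENNReal.ofReal p) (ENNReal.ofReal q) φ
        (weinsteinTransform d α κ (ENNReal.ofReal p) (ENNReal.ofReal q) φ) ∧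
      eLpNorm (weinsteinTransform d α κ (ENNReal.ofReal p) (ENNReal.ofReal q) φ)
          (ENNReal.ofReal q) (weinsteinMeasure d α κ) ≤
        (weinsteinMeasure d α κ Sig ^ (1 / q) * weinsteinMeasure d α κ Ω ^ (1 / q) + (εΩ : ℝ≥0∞)) /
            (1 - (εSig : ℝ≥0∞)) *
          eLpNorm φ (ENNReal.ofReal p) (weinsteinMeasure d α κ) := by
  have hα' : -1 / 2 ≤ α := hα.le
  have hc0 := weinsteinConst_pos d hα'
  have hc1 := weinsteinConst_le_one hd hα'
  have hκ0 : 0 ≤ κ := by rcases hκ with rfl | rfl <;> positivity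
  have hκ1 : κ ≤ weinsteinConst d α := by
    rcases hκ with rfl | rfl
    · exact le_rfl
    -- From c ≤ 1 it follows that c² ≤ c.
    · nlinarith
  have hpq : p.HolderConjugate q := (Real.holderConjugate_iff_eq_conjExponent hp1).2 hq
  have hq1 : 1 ≤ ENNReal.ofReal q := by simpa using hpq.symm.lt.le
  have hT := isWeinsteinTransform_weinsteinTransform hα' hκ0 hκ1 hpq hp2 hφ
  refine ⟨hT, ?_⟩
  set g := weinsteinTransform d α κ (ENNReal.ofReal p) (ENNReal.ofReal q) φ
  have hS := eLpNorm_indicator_le_of_isWeinsteinTransform hα' hκ0 hκ1 hpq hp2 hΩ hSig hφ hφΩ hT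
  rw [← ENNReal.mul_div_right_comm]
  refine ENNReal.le_div_one_sub_of_le_mul_add hT.1.eLpNorm_ne_top (by exact_mod_cast hεSig) ?_
  have h := eLpNorm_add_le (hT.1.1.sub (hT.1.1.indicator hSig)) (hT.1.1.indicator hSig) hq1
  rw [sub_add_cancel] at h
  exact h.trans (add_le_add hφSig hS)
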